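/- **Setting.** Let $2\le n_t\le n_r$, let $\omega:\mathbb R\to\mathbb R$ (only its values on $(0,\infty)$ matter) and write $\mathcal M\omega(s)=\int_0^\infty x^{s-1}\omega(x)\,dx$. Assume that $\omega$ is $n_t-2$ times continuously differentiable on $(0,\infty)$ with locally absolutely continuous derivative $\omega^{(n_t-2)}$ there, that $\int_0^\infty \lambda^a\,|\partial_\lambda^b[\lambda^b\omega(\lambda)]|\,d\lambda<\infty$ for $0\le a,b\le n_t-1$, and that $\mathcal M\omega(l+1)\ne0$ for $0\le l\le n_t-1$. Put $$p_l(\lambda)=\sum_{j=0}^l\frac{(-1)^{l-j}\,l!\,\mathcal M\omega(l+1)}{j!\,(l-j)!\,\mathcal M\omega(j+1)}\lambda^j,\qquad q_l(\lambda)=\frac{1}{l!\,\mathcal M\omega(l+1)}\,\partial_\lambda^l[(-\lambda)^l\omega(\lambda)],\qquad K(x,y)=\sum_{j=0}^{n_t-1}p_j(x)q_j(y).$$ Let $\mathbf P$ be a random complex $n_r\times n_t$ matrix which is a Pólya ensemble with weight $\omega$: $\mathbf P^\dagger\mathbf P$ is distributed as $\mathbf U^\dagger\boldsymbol\Lambda\mathbf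 U$, where $\mathbf U\in\mathcal U(n_t)$ is Haar distributed and, independently of $\mathbf U$, $\boldsymbol\Lambda=\mathrm{diag}(\lambda_1,\dots,\lambda_{n_t})>0$ has the (nonnegative) joint density $\frac1{n_t!}\prod_{k>\ell}(\lambda_k-\lambda_\ell)\,\det[q_{b-1}(\lambda_a)]_{a,b=1,\dots,n_t}$. Let $\boldsymbol\Sigma_t$ be a deterministic positive definite Hermitian $n_t\times n_t$ matrix, $\sigma_k=(\boldsymbol\Sigma_t^{-1})_{kk}$, $\mathbf H=\mathbf P\sqrt{\boldsymbol\Sigma_t}$, and $\delta>0$. The zero-forcing SINR of the $k$-th stream is $\gamma_k=\delta/[(\mathbf H^\dagger\mathbf H)^{-1}]_{kk}$, and the sum rate is $R=\sum_{k=1}^{n_t}\mathbb E[\ln(1+\gamma_k)]$. Finally, for $x>0$ and any $r\in(0,1)$, let $$G^{1,2}_{2,2}\left(\left.\begin{array}{c}1,1;-\\1;0\end{array}\right|x\right)=\int_{r-i\infty}^{r+i\infty}\frac{ds}{2\pi i}\,\frac{\Gamma(1-s)\,\Gamma(s)^2}{\Gamma(1+s)}\,x^s .$$ **Claim.** 1.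 The $p_j$ are monic of degree $j$ and $\int_0^\infty p_aq_b\,d\lambda=\delta_{ab}$ for $0\le a,b<n_t$ (so $K$ is the correlation kernel of the ensemble), and $$K(0,y)=\frac{1}{(n_t-1)!\,\mathcal M\omega(1)}\,\frac1y\,\partial_y^{n_t-1}[y^{n_t}\omega(y)]$$ at every $y>0$ at which $\omega^{(n_t-2)}$ is differentiable, hence for almost every $y>0$. 2. For every $k$, $\gamma_k$ has on $(0,\infty)$ the nonnegative probability density $$\rho(\gamma)=\frac{\sigma_k}{\delta\,\mathcal M\omega(1)}\,\omega\!\left(\frac{\sigma_k\gamma}{\delta}\right);$$ for given $\sigma_k$ and $\delta$ this expression does not involve $n_t$. 3. Every $\ln(1+\gamma_k)$ is integrable, the following integral converges absolutely, and $$R=\frac1{\mathcal M\omega(1)}\int_0^\infty \omega(x)\sum_{k=1}^{n_t}G^{1,2}_{2,2}\left(\left.\begin{array}{c}1,1;-\\1;0\end{array}\right|\frac{\delta x}{\sigma_k}\right)dx .$$ 4. If $\boldsymbol\Sigma_t=\mathbf I$, the sum rate is exactly linear in $n_t$ (for given $\omega$ and $\delta$): $$R=n_t\cdot\frac1{\mathcal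 M\omega(1)}\int_0^\infty \omega(x)\,G^{1,2}_{2,2}\left(\left.\begin{array}{c}1,1;-\\1;0\end{array}\right|\delta x\right)dx .$$ -/

import Mathlib

open MeasureTheory Set
open scoped ComplexOrder MatrixOrder Nat Matrix

noncomputable section

namespace ZFMimo

/-! ### Random complex matrices and Haar measure on the unitary group -/

/-- Entrywise (product) measurable structure on complex matrices. -/
instance matrixMeasurableSpace {m n : Type*} : MeasurableSpace (Matrix m n ℂ) :=
  inferInstanceAs (MeasurableSpace (m → n → ℂ))

instance matrixBorelSpace {m n : Type*} [Countable m] [Countable n] :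
    BorelSpace (Matrix m n ℂ) :=
  inferInstanceAs (BorelSpace (m → n → ℂ))

instance unitaryGroupCompactSpace (n : ℕ) :
    CompactSpace (Matrix.unitaryGroup (Fin n) ℂ) := by
  have hclosed : IsClosed ((Matrix.unitaryGroup (Fin n) ℂ : Submonoid _) :
      Set (Matrix (Fin n) (Fin n) ℂ)) := by
    have h : ((Matrix.unitaryGroup (Fin n) ℂ : Submonoid _) :
        Set (Matrix (Fin n) (Fin n) ℂ)) = {A | A * star A = 1} := by
      ext A
      exact Matrix.mem_unitaryGroup_iff
    rw [h]
    exact isClosed_eq (by fun_prop) continuous_const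
  have hK : IsCompact (Set.pi Set.univ
      (fun _ : Fin n => Set.pi Set.univ (fun _ : Fin n => Metric.closedBall (0 : ℂ) 1))) :=
    isCompact_univ_pi fun _ => isCompact_univ_pi fun _ => isCompact_closedBall _ _
  refine isCompact_iff_compactSpace.mp (hK.of_isClosed_subset hclosed ?_)
  intro A hA i _ j _
  simpa using entry_norm_bound_of_unitary hA i j

/-- The Haar probability measure on the unitary group `U(n)`. -/
def haarUnitary (n : ℕ) : Measure (Matrix.unitaryGroup (Fin n) ℂ) :=
  Measure.haarMeasure ⊤

/-! ### Invariant polynomial ensembles -/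

/-- The joint eigenvalue function `(1/n!) Δ(Λ) det[q_{b-1}(λ_a)]` of a polynomial ensemble;
`det (vandermonde Λ) = ∏_{k > l} (λ_k - λ_l)`. -/
def eigenDensity (n : ℕ) (q : ℕ → ℝ → ℝ) (Λ : Fin n → ℝ) : ℝ :=
  (1 / (n ! : ℝ)) * (Matrix.vandermonde Λ).det *
    (Matrix.of fun a b : Fin n => q (b : ℕ) (Λ a)).det

/-- Lebesgue measure on `(0, ∞)^n`. -/
def orthantVolume (n : ℕ) : Measure (Fin n → ℝ) :=
  volume.restrict {Λ | ∀ i, 0 < Λ i}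

/-- The law of `U† diag(Λ) U` with `U` Haar distributed on `U(n)` and, independently of `U`, the
vector `Λ` distributed on `(0, ∞)^n` with density `eigenDensity n q`. -/
def invariantLaw (n : ℕ) (q : ℕ → ℝ → ℝ) : Measure (Matrix (Fin n) (Fin n) ℂ) :=
  ((haarUnitary n).prod
      ((orthantVolume n).withDensity fun Λ => ENNReal.ofReal (eigenDensity n q Λ))).map
    fun x => (x.1 : Matrix (Fin n) (Fin n) ℂ)ᴴ * Matrix.diagonal (fun i => (x.2 i : ℂ)) *
      (x.1 : Matrix (Fin n) (Fin n) ℂ)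

/-- `P` is an invariant polynomial ensemble with weights `q_0, …, q_{n_t - 1}`: the Gram matrix
`P† P` is distributed as `U† Λ U`, with `U` Haar distributed and `Λ` having the joint density
`(1/n_t!) Δ(Λ) det[q_{b-1}(λ_a)]`. -/
structure IsInvariantPolynomialEnsemble {Ω : Type*} [MeasurableSpace Ω] (μ : Measure Ω)
    {nr nt : ℕ} (P : Ω → Matrix (Fin nr) (Fin nt) ℂ) (q : ℕ → ℝ → ℝ) : Prop where
  aemeasurable : AEMeasurable P μ
  density_nonneg : ∀ᵐ Λ ∂(orthantVolume nt), 0 ≤ eigenDensity nt q Λ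
  map_gram : μ.map (fun w => (P w)ᴴ * P w) = invariantLaw nt q

/-- Monic polynomials `p_0, …, p_{n-1}`, `deg p_j = j`, biorthonormal to `q_0, …, q_{n-1}`
on `(0, ∞)`. -/
def IsBiorthonormal (n : ℕ) (p : ℕ → Polynomial ℝ) (q : ℕ → ℝ → ℝ) : Prop :=
  (∀ j < n, (p j).Monic ∧ (p j).natDegree = j) ∧
  ∀ a < n, ∀ b < n, IntegrableOn (fun x => (p a).eval x * q b x) (Ioi 0) ∧
    ∫ x in Ioi (0 : ℝ), (p a).eval x * q b x = if a = b then 1 else 0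

/-- The correlation kernel `K(x, y) = ∑_{j < n} p_j(x) q_j(y)`. -/
def kernel (n : ℕ) (p : ℕ → Polynomial ℝ) (q : ℕ → ℝ → ℝ) (x y : ℝ) : ℝ :=
  ∑ j ∈ Finset.range n, (p j).eval x * q j y

/-! ### Pólya ensembles -/

/-- The Mellin transform `Mω(s) = ∫_0^∞ x^{s-1} ω(x) dx` of a real function at a real point. -/
def mellinAt (ω : ℝ → ℝ) (s : ℝ) : ℝ :=
  ∫ x in Ioi (0 : ℝ), x ^ (s - 1) * ω x

theorem mellinAt_eq_mellin (ω : ℝ → ℝ) (s : ℝ) :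
    (mellinAt ω s : ℂ) = mellin (fun x => (ω x : ℂ)) (s : ℂ) := by
  unfold mellinAt mellin
  rw [← integral_complex_ofReal]
  refine setIntegral_congr_fun measurableSet_Ioi fun x hx => ?_
  have hx' : (0 : ℝ) ≤ x := le_of_lt hx
  simp only [smul_eq_mul, Complex.ofReal_mul, Complex.ofReal_cpow hx', Complex.ofReal_sub,
    Complex.ofReal_one]

/-- `p_l(λ) = ∑_{j ≤ l} (-1)^{l-j} l! Mω(l+1) / (j! (l-j)! Mω(j+1)) λ^j`. -/
def polyaP (ω : ℝ → ℝ) (l : ℕ) : Polynomial ℝ :=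
  ∑ j ∈ Finset.range (l + 1),
    Polynomial.C ((-1) ^ (l - j) * (l ! : ℝ) * mellinAt ω (l + 1) /
      ((j ! : ℝ) * ((l - j)! : ℝ) * mellinAt ω (j + 1))) * Polynomial.X ^ j

/-- `q_l(λ) = 1 / (l! Mω(l+1)) ∂_λ^l [(-λ)^l ω(λ)]`. -/
def polyaQ (ω : ℝ → ℝ) (l : ℕ) (y : ℝ) : ℝ :=
  1 / ((l ! : ℝ) * mellinAt ω (l + 1)) * iteratedDeriv l (fun x => (-x) ^ l * ω x) y

/-- The regularity of the weight that the definition of the functions `q_l` and their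
biorthonormality with polynomials presuppose (for `n ≥ 2`): `ω` is `n - 2` times continuously
differentiable on `(0, ∞)`, its derivative of order `n - 2` is locally absolutely continuous there
(so the derivative of order `n - 1` exists almost everywhere), the moments of orders
`0, …, n - 1` of `∂^b[λ^b ω(λ)]`, `b < n`, are finite, and the Mellin transforms in the
denominators do not vanish. -/
structure IsPolyaWeight (n : ℕ) (ω : ℝ → ℝ) : Prop where
  contDiffOn : ContDiffOn ℝ ((n - 2 : ℕ) : WithTop ℕ∞) ω (Ioi 0)
  locallyAC : ∀ a b : ℝ, 0 < a → a ≤ b →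
    AbsolutelyContinuousOnInterval (iteratedDeriv (n - 2) ω) a b
  integrableOn : ∀ a < n, ∀ b < n,
    IntegrableOn (fun y => y ^ a * iteratedDeriv b (fun x => x ^ b * ω x) y) (Ioi 0)
  mellin_ne_zero : ∀ l < n, mellinAt ω (l + 1) ≠ 0

/-- `P` is a Pólya ensemble with weight `ω`: an invariant polynomial ensemble with the functions
`q_l = polyaQ ω l`. -/
structure IsPolyaEnsemble {Ω : Type*} [MeasurableSpace Ω] (μ : Measure Ω)
    {nr nt : ℕ} (P : Ω → Matrix (Fin nr) (Fin nt) ℂ) (ω : ℝ → ℝ) : Prop where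
  weight : IsPolyaWeight nt ω
  ensemble : IsInvariantPolynomialEnsemble μ P (polyaQ ω)

/-- The correlation kernel of the Pólya ensemble of size `n` with weight `ω`. -/
def polyaKernel (n : ℕ) (ω : ℝ → ℝ) : ℝ → ℝ → ℝ :=
  kernel n (polyaP ω) (polyaQ ω)

/-! ### The zero-forcing receiver -/

/-- The channel matrix `H = P √Σ_t`. -/
def channel {nr nt : ℕ} (P : Matrix (Fin nr) (Fin nt) ℂ) (S : Matrix (Fin nt) (Fin nt) ℂ) :
    Matrix (Fin nr) (Fin nt) ℂ :=
  P * CFC.sqrt S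

/-- `γ_k = δ / [(H† H)⁻¹]_{kk}`; the diagonal entry is real as the matrix is Hermitian. -/
def zfSINR {nr nt : ℕ} (δ : ℝ) (H : Matrix (Fin nr) (Fin nt) ℂ) (k : Fin nt) : ℝ :=
  δ / ((Hᴴ * H)⁻¹ k k).re

/-- `σ_k = (Σ_t⁻¹)_{kk}`, real as `Σ_t` is Hermitian. -/
def invDiag {nt : ℕ} (S : Matrix (Fin nt) (Fin nt) ℂ) (k : Fin nt) : ℝ :=
  (S⁻¹ k k).re

/-- The ergodic sum rate `R = ∑_k E[ln(1 + γ_k)]` of the zero-forcing receiver. -/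
def zfSumRate {Ω : Type*} [MeasurableSpace Ω] (μ : Measure Ω) {nr nt : ℕ} (δ : ℝ)
    (H : Ω → Matrix (Fin nr) (Fin nt) ℂ) : ℝ :=
  ∑ k : Fin nt, ∫ w, Real.log (1 + zfSINR δ (H w) k) ∂μ

/-! ### Meijer G-functions -/

/-- The integrand
`∏Γ(c_j - s) ∏Γ(1 - a_j + s) / (∏Γ(b_j - s) ∏Γ(1 - d_j + s)) x^s`. -/
def meijerIntegrand (a b c d : List ℂ) (x : ℝ) (s : ℂ) : ℂ :=
  ((c.map fun u => Complex.Gamma (u - s)).prod *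
      (a.map fun u => Complex.Gamma (1 - u + s)).prod) /
    ((b.map fun u => Complex.Gamma (u - s)).prod *
      (d.map fun u => Complex.Gamma (1 - u + s)).prod) * (x : ℂ) ^ s

/-- The line `Re s = r` has all poles of the `Γ(c_j - s)` on its right and all poles of the
`Γ(1 - a_j + s)` on its left. -/
def Separates (r : ℝ) (a c : List ℂ) : Prop :=
  (∀ u ∈ a, u.re - 1 < r) ∧ ∀ u ∈ c, r < u.re

/-- The Meijer G-function `G(a; b | c; d | x) = ∫ ds/(2πi) meijerIntegrand a b c d x s`, with
`a = (a_1, …, a_n)`, `b = (b_1, …, b_p)`, `c = (c_1, …, c_m)`, `d = (d_1, …, d_q)` and upper indices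
`(m, n)`, lower indices `(n + p, m + q)`; the contour is the upward line `s = r + i t`, where `r` is
to satisfy `Separates r a c`. -/
def meijerG (r : ℝ) (a b c d : List ℂ) (x : ℝ) : ℂ :=
  1 / (2 * (Real.pi : ℂ)) * ∫ t : ℝ, meijerIntegrand a b c d x ((r : ℂ) + t * Complex.I)

end ZFMimo

end

open ZFMimo

/-!
Write `σ = σ_k`, `n = n_t`. For eigenvalues `Λ`, the average of `(γ_k / (γ_k + z)) ^ n` over the
Haar unitary is `∏ λ_i / (λ_i + σ z / δ)`: multiply by `π ^ n` and compare two evaluations of a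
Gaussian integral over `ℂⁿ`. For a biorthonormal ensemble, Andréief's identity and the
biorthonormality of the `p_j`, `q_j` turn the eigenvalue average of this product, with
`w = σ z / δ`, into `∫ y / (y + w) K(0, y) dy`. For a Pólya weight, `K(0, y)` is a multiple of
`y⁻¹ ∂^{n-1}[yⁿ ω(y)]`, and `n - 1` integrations by parts against `1 / (y + w)` leave
`Mω(1)⁻¹ ∫ (y / (y + w)) ^ n ω(y) dy`, the same transform of the rescaled weight. The transform
determines a finite measure on `(0, ∞)`, its `z`-derivatives at `z = 1` being moments of a measure
on a bounded interval; hence `γ_k` has the claimed density.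

For the sum rate, the Mellin transform of `ln (1 + 1 / x)` on `0 < Re s < 1` is
`Γ(s) Γ(1 - s) / s`, so Mellin inversion identifies the Meijer G-function with `ln (1 + x)`.
-/

namespace ZFMimo

/-- Local absolute continuity on the open half-line `(0, ∞)`. -/
def LocallyACOnPos (f : ℝ → ℝ) : Prop :=
  ∀ a b : ℝ, 0 < a → a ≤ b → AbsolutelyContinuousOnInterval f a b

/-- `∂^b [x ^ m ω]`. The functions `q_l` are multiples of the case `m = b`, the kernel at `x = 0`
is a multiple of `1 / y` times the case `m = b + 1`. -/
noncomputable def weightDeriv (ω : ℝ → ℝ) (b m : ℕ) : ℝ → ℝ :=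
  iteratedDeriv b fun x => x ^ m * ω x

section LocallyAC

variable {f g : ℝ → ℝ} {L : ℝ}

theorem uIcc_subset_Ioi {a b : ℝ} (ha : 0 < a) (hab : a ≤ b) : uIcc a b ⊆ Ioi 0 :=
  uIcc_of_le hab ▸ Icc_subset_Ioi_iff hab |>.2 ha

theorem locallyACOnPos_of_contDiffOn (hf : ContDiffOn ℝ 1 f (Ioi 0)) : LocallyACOnPos f :=
  fun _ _ ha hab => (hf.mono (uIcc_subset_Ioi ha hab)).absolutelyContinuousOnInterval

theorem LocallyACOnPos.mul (hf : LocallyACOnPos f) (hg : LocallyACOnPos g) :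
    LocallyACOnPos fun y => f y * g y :=
  fun a b ha hab => (hf a b ha hab).fun_mul (hg a b ha hab)

theorem LocallyACOnPos.add (hf : LocallyACOnPos f) (hg : LocallyACOnPos g) :
    LocallyACOnPos fun y => f y + g y :=
  fun a b ha hab => (hf a b ha hab).fun_add (hg a b ha hab)

theorem LocallyACOnPos.congr (hf : LocallyACOnPos f) (h : EqOn f g (Ioi 0)) :
    LocallyACOnPos g := by
  intro a b ha hab
  have hfab := hf a b ha hab
  rw [absolutelyContinuousOnInterval_iff] at hfab ⊢
  intro ε hε
  obtain ⟨η, hη, H⟩ := hfab ε hε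
  refine ⟨η, hη, fun E hE hlt => lt_of_eq_of_lt (Finset.sum_congr rfl fun i hi => ?_) (H E hE hlt)⟩
  rw [h (uIcc_subset_Ioi ha hab (hE.1 i hi).1), h (uIcc_subset_Ioi ha hab (hE.1 i hi).2)]

theorem LocallyACOnPos.ae_differentiableAt (hf : LocallyACOnPos f) :
    ∀ᵐ y : ℝ, 0 < y → DifferentiableAt ℝ f y := by
  have hk : ∀ k : ℕ, ∀ᵐ y : ℝ, y ∈ uIcc (Real.exp (-k)) (Real.exp k) → DifferentiableAt ℝ f y :=
    fun k => (hf _ _ (Real.exp_pos _) (Real.exp_le_exp.2 (by simp))).ae_differentiableAt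
  filter_upwards [ae_all_iff.2 hk] with y hy hy0
  obtain ⟨k, hlog⟩ := exists_nat_ge |Real.log y|
  obtain ⟨hlow, hupp⟩ := abs_le.1 hlog
  exact hy k (Icc_subset_uIcc
    ⟨(Real.le_log_iff_exp_le hy0).1 hlow, (Real.log_le_iff_le_exp hy0).1 hupp⟩)

theorem integrable_comp_exp (hf : IntegrableOn (fun y => f y / y) (Ioi 0)) :
    Integrable fun t => f (Real.exp t) := by
  rw [← Real.range_exp, ← image_univ, integrableOn_image_iff_integrableOn_abs_deriv_smul
    MeasurableSet.univ (fun t _ => (Real.hasDerivAt_exp t).hasDerivWithinAt)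
    Real.exp_injective.injOn, integrableOn_univ] at hf
  refine hf.congr (Filter.Eventually.of_forall fun t => ?_)
  simp only [abs_of_pos (Real.exp_pos t), smul_eq_mul, mul_div_cancel₀ _ (Real.exp_ne_zero t)]

theorem eq_zero_of_tendsto_atTop_of_integrableOn_div
    (hf : IntegrableOn (fun y => f y / y) (Ioi 0)) (hL : Filter.Tendsto f Filter.atTop (nhds L)) :
    L = 0 := by
  refine IntegrableAtFilter.eq_zero_of_tendsto (l := Filter.atTop)
    ((integrable_comp_exp hf).integrableAtFilter _) (fun s hs => ?_)
    (hL.comp Real.tendsto_exp_atTop)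
  obtain ⟨a, ha⟩ := Filter.mem_atTop_sets.1 hs
  exact measure_mono_top ha (Real.volume_Ici (a := a))

theorem eq_zero_of_tendsto_zero_of_integrableOn_div
    (hf : IntegrableOn (fun y => f y / y) (Ioi 0))
    (hL : Filter.Tendsto f (nhdsWithin 0 (Ioi 0)) (nhds L)) : L = 0 := by
  refine IntegrableAtFilter.eq_zero_of_tendsto (l := Filter.atBot)
    ((integrable_comp_exp hf).integrableAtFilter _) (fun s hs => ?_)
    (hL.comp Real.tendsto_exp_atBot_nhdsGT)
  obtain ⟨a, ha⟩ := Filter.mem_atBot_sets.1 hs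
  exact measure_mono_top ha (Real.volume_Iic (a := a))

theorem LocallyACOnPos.tendsto_atTop (hf : LocallyACOnPos f)
    (hd : IntegrableOn (deriv f) (Ioi 1)) :
    Filter.Tendsto f Filter.atTop (nhds (f 1 + ∫ y in Ioi (1 : ℝ), deriv f y)) := by
  refine ((intervalIntegral_tendsto_integral_Ioi 1 hd Filter.tendsto_id).const_add (f 1)).congr' ?_
  filter_upwards [Filter.eventually_ge_atTop 1] with v hv
  rw [id, (hf 1 v one_pos hv).integral_deriv_eq_sub]
  ring

theorem LocallyACOnPos.tendsto_zero (hf : LocallyACOnPos f)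
    (hd : IntegrableOn (deriv f) (Ioc 0 1)) :
    Filter.Tendsto f (nhdsWithin 0 (Ioi 0))
      (nhds (f 1 - ∫ y in Ioc (0 : ℝ) 1, deriv f y)) := by
  have hcover := aecover_Ioc_of_Ioc (μ := volume) (A := (0 : ℝ)) (B := 1)
    (Filter.tendsto_id.mono_left nhdsWithin_le_nhds)
    (tendsto_const_nhds (f := nhdsWithin 0 (Ioi 0)))
  refine ((hcover.integral_tendsto_of_countably_generated hd).const_sub (f 1)).congr' ?_
  filter_upwards [Ioc_mem_nhdsGT (zero_lt_one' ℝ)] with u hu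
  rw [Measure.restrict_restrict measurableSet_Ioc,
    inter_eq_left.2 (Ioc_subset_Ioc_left (id_eq u ▸ hu.1.le)), id_eq,
    ← intervalIntegral.integral_of_le hu.2, (hf u 1 hu.1 hu.2).integral_deriv_eq_sub]
  ring

theorem LocallyACOnPos.integral_deriv_eq_zero (hf : LocallyACOnPos f)
    (hd : IntegrableOn (deriv f) (Ioi 0)) (hdiv : IntegrableOn (fun y => f y / y) (Ioi 0)) :
    ∫ y in Ioi (0 : ℝ), deriv f y = 0 := by
  have hd1 : IntegrableOn (deriv f) (Ioi 1) := hd.mono_set (Ioi_subset_Ioi zero_le_one)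
  have hd0 : IntegrableOn (deriv f) (Ioc 0 1) := hd.mono_set Ioc_subset_Ioi_self
  have htop := eq_zero_of_tendsto_atTop_of_integrableOn_div hdiv (hf.tendsto_atTop hd1)
  have hbot := eq_zero_of_tendsto_zero_of_integrableOn_div hdiv (hf.tendsto_zero hd0)
  rw [← Ioc_union_Ioi_eq_Ioi (zero_le_one' ℝ),
    setIntegral_union (Ioc_disjoint_Ioi le_rfl) measurableSet_Ioi hd0 hd1]
  linarith

-- Integrability of `f g / y` makes the boundary terms vanish, as `1 / y` is integrable at neither
-- end of the half-line.
theorem LocallyACOnPos.integral_mul_deriv_eq_neg (hf : LocallyACOnPos f) (hg : LocallyACOnPos g)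
    (hfg : IntegrableOn (fun y => f y * g y / y) (Ioi 0))
    (hfg' : IntegrableOn (fun y => f y * deriv g y) (Ioi 0))
    (hf'g : IntegrableOn (fun y => deriv f y * g y) (Ioi 0)) :
    ∫ y in Ioi (0 : ℝ), f y * deriv g y = -∫ y in Ioi (0 : ℝ), deriv f y * g y := by
  have hderiv : (fun y => deriv f y * g y + f y * deriv g y) =ᵐ[volume.restrict (Ioi 0)]
      deriv fun y => f y * g y := by
    filter_upwards [ae_restrict_mem measurableSet_Ioi, ae_restrict_of_ae hf.ae_differentiableAt,
      ae_restrict_of_ae hg.ae_differentiableAt] with y hy hfy hgy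
    exact (deriv_fun_mul (hfy hy) (hgy hy)).symm
  have hzero := (hf.mul hg).integral_deriv_eq_zero ((hf'g.add hfg').congr hderiv) hfg
  rw [← integral_congr_ae hderiv, integral_add hf'g hfg'] at hzero
  exact eq_neg_of_add_eq_zero_right hzero

end LocallyAC

section IteratedDeriv

variable {s : Set ℝ} {F : ℝ → ℝ} {b : ℕ} {y : ℝ}

theorem contDiffOn_iteratedDeriv_of_isOpen (hs : IsOpen s) {m j : ℕ}
    (hF : ContDiffOn ℝ ((j + m : ℕ) : WithTop ℕ∞) F s) :
    ContDiffOn ℝ (j : WithTop ℕ∞) (iteratedDeriv m F) s := by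
  induction m generalizing j with
  | zero => simpa using hF
  | succ m ih =>
    rw [iteratedDeriv_succ]
    exact (ih (j := j + 1) (by rwa [add_right_comm, add_assoc])).deriv_of_isOpen hs (by norm_cast)

theorem iteratedDeriv_id_mul (hF : ContDiffAt ℝ b F y) :
    iteratedDeriv b (fun x => x * F x) y =
      y * iteratedDeriv b F y + b * iteratedDeriv (b - 1) F y := by
  rw [iteratedDeriv_fun_mul (f := fun x : ℝ => x) contDiffAt_id hF]
  rcases b with _ | b
  · simp
  · rw [Finset.sum_range_succ', Finset.sum_range_succ']
    simp [iteratedDeriv_fun_id]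
    ring

theorem hasDerivAt_iteratedDeriv_id_mul (hs : IsOpen s)
    (hF : ContDiffOn ℝ (b : WithTop ℕ∞) F s) (hy : y ∈ s)
    (hd : DifferentiableAt ℝ (iteratedDeriv b F) y) :
    HasDerivAt (iteratedDeriv b (fun x => x * F x))
      (y * iteratedDeriv (b + 1) F y + (b + 1) * iteratedDeriv b F y) y := by
  have hlocal : iteratedDeriv b (fun x => x * F x) =ᶠ[nhds y]
      fun x => x * iteratedDeriv b F x + b * iteratedDeriv (b - 1) F x := by
    filter_upwards [hs.mem_nhds hy] with x hx
    exact iteratedDeriv_id_mul (hF.contDiffAt (hs.mem_nhds hx))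
  have hleft : HasDerivAt (fun x => x * iteratedDeriv b F x)
      (1 * iteratedDeriv b F y + y * iteratedDeriv (b + 1) F y) y := by
    rw [iteratedDeriv_succ]
    exact (hasDerivAt_id y).mul hd.hasDerivAt
  have hright : HasDerivAt (fun x => (b : ℝ) * iteratedDeriv (b - 1) F x)
      (b * iteratedDeriv b F y) y := by
    rcases b with _ | b
    · simpa using hasDerivAt_const y (0 : ℝ)
    · have hdb : DifferentiableAt ℝ (iteratedDeriv b F) y :=
        ((contDiffOn_iteratedDeriv_of_isOpen hs (j := 1) (by rwa [add_comm])).contDiffAt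
          (hs.mem_nhds hy)).differentiableAt (by simp)
      simpa [iteratedDeriv_succ] using hdb.hasDerivAt.const_mul ((b + 1 : ℕ) : ℝ)
  refine ((hleft.add hright).congr_of_eventuallyEq hlocal).congr_deriv ?_
  ring

end IteratedDeriv

section PolyaWeight

variable {n : ℕ} {ω : ℝ → ℝ} {b m : ℕ} {y : ℝ}

theorem deriv_weightDeriv : deriv (weightDeriv ω b m) = weightDeriv ω (b + 1) m :=
  iteratedDeriv_succ.symm

theorem IsPolyaWeight.contDiffOn_pow_mul (h : IsPolyaWeight n ω) (hb : b ≤ n - 2) :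
    ContDiffOn ℝ (b : WithTop ℕ∞) (fun x => x ^ m * ω x) (Ioi 0) :=
  (contDiff_id.pow m).contDiffOn.mul (h.contDiffOn.of_le (by exact_mod_cast hb))

theorem IsPolyaWeight.contDiffOn_weightDeriv (h : IsPolyaWeight n ω) (hb : b < n - 2) :
    ContDiffOn ℝ 1 (weightDeriv ω b m) (Ioi 0) :=
  contDiffOn_iteratedDeriv_of_isOpen isOpen_Ioi (j := 1)
    (by rw [add_comm]; exact h.contDiffOn_pow_mul hb)

theorem weightDeriv_succ_right (hω : ContDiffAt ℝ b (fun x => x ^ m * ω x) y) :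
    weightDeriv ω b (m + 1) y = y * weightDeriv ω b m y + b * weightDeriv ω (b - 1) m y := by
  simp only [weightDeriv, pow_succ', mul_assoc]
  exact iteratedDeriv_id_mul hω

theorem IsPolyaWeight.locallyACOnPos_weightDeriv (h : IsPolyaWeight n ω) (hb : b ≤ n - 2) :
    LocallyACOnPos (weightDeriv ω b m) := by
  rcases hb.lt_or_eq with hb | rfl
  · exact locallyACOnPos_of_contDiffOn (h.contDiffOn_weightDeriv hb)
  induction m with
  | zero =>
    simp only [weightDeriv, pow_zero, one_mul]
    exact h.locallyAC
  | succ m ih =>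
    have hlower : ContDiffOn ℝ 1
        (fun y => ((n - 2 : ℕ) : ℝ) * weightDeriv ω (n - 2 - 1) m y) (Ioi 0) := by
      rcases Nat.eq_zero_or_pos (n - 2) with hzero | hpos
      · simpa only [hzero, Nat.cast_zero, zero_mul] using contDiffOn_const
      · exact contDiffOn_const.mul (h.contDiffOn_weightDeriv (by omega))
    refine (((locallyACOnPos_of_contDiffOn contDiffOn_id).mul ih).add
      (locallyACOnPos_of_contDiffOn hlower)).congr fun y hy => ?_
    exact (weightDeriv_succ_right
      ((h.contDiffOn_pow_mul le_rfl).contDiffAt (isOpen_Ioi.mem_nhds hy))).symm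

theorem IsPolyaWeight.differentiableAt_weightDeriv (h : IsPolyaWeight n ω) (hb : b ≤ n - 2)
    (hy : 0 < y) (hd : DifferentiableAt ℝ (iteratedDeriv (n - 2) ω) y) :
    DifferentiableAt ℝ (weightDeriv ω b m) y := by
  rcases hb.lt_or_eq with hb | rfl
  · exact ((h.contDiffOn_weightDeriv hb).contDiffAt
      (isOpen_Ioi.mem_nhds hy)).differentiableAt one_ne_zero
  induction m with
  | zero => simpa only [weightDeriv, pow_zero, one_mul] using hd
  | succ m ih =>
    simp only [weightDeriv, pow_succ', mul_assoc]
    exact (hasDerivAt_iteratedDeriv_id_mul isOpen_Ioi (h.contDiffOn_pow_mul le_rfl)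
      hy ih).differentiableAt

theorem IsPolyaWeight.weightDeriv_succ_succ (h : IsPolyaWeight n ω) (hb : b ≤ n - 2)
    (hy : 0 < y) (hd : DifferentiableAt ℝ (iteratedDeriv (n - 2) ω) y) :
    weightDeriv ω (b + 1) (m + 1) y =
      y * weightDeriv ω (b + 1) m y + (b + 1) * weightDeriv ω b m y := by
  rw [← deriv_weightDeriv]
  simp only [weightDeriv, pow_succ', mul_assoc]
  exact (hasDerivAt_iteratedDeriv_id_mul isOpen_Ioi (h.contDiffOn_pow_mul hb) hy
    (h.differentiableAt_weightDeriv hb hy hd)).deriv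

theorem IsPolyaWeight.ae_differentiableAt (h : IsPolyaWeight n ω) :
    ∀ᵐ y : ℝ, 0 < y → DifferentiableAt ℝ (iteratedDeriv (n - 2) ω) y :=
  LocallyACOnPos.ae_differentiableAt h.locallyAC

end PolyaWeight

section Kernel

variable {n : ℕ} {ω : ℝ → ℝ} {y : ℝ}

theorem polyaQ_eq (ω : ℝ → ℝ) (l : ℕ) (y : ℝ) :
    polyaQ ω l y = (-1) ^ l / ((l ! : ℝ) * mellinAt ω (l + 1)) * weightDeriv ω l l y := by
  have hsign : (fun x : ℝ => (-x) ^ l * ω x) = fun x => (-1) ^ l * (x ^ l * ω x) := by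
    ext x
    rw [neg_pow, mul_assoc]
  rw [polyaQ, hsign, iteratedDeriv_const_mul_field, weightDeriv]
  ring

theorem polyaP_eq (ω : ℝ → ℝ) (l : ℕ) :
    polyaP ω l = ∑ j ∈ Finset.range (l + 1), Polynomial.C (mellinAt ω (l + 1) /
      mellinAt ω (j + 1) * ((-1) ^ (l - j) * (l.choose j : ℝ))) * Polynomial.X ^ j := by
  refine Finset.sum_congr rfl fun j hj => ?_
  rw [Nat.cast_choose ℝ (Nat.lt_succ_iff.1 (Finset.mem_range.1 hj))]
  congr 2
  ring

theorem eval_polyaP (ω : ℝ → ℝ) (l : ℕ) (x : ℝ) :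
    (polyaP ω l).eval x = ∑ j ∈ Finset.range (l + 1), mellinAt ω (l + 1) /
      mellinAt ω (j + 1) * ((-1) ^ (l - j) * (l.choose j : ℝ)) * x ^ j := by
  simp only [polyaP_eq, Polynomial.eval_finsetSum, Polynomial.eval_mul, Polynomial.eval_C,
    Polynomial.eval_pow, Polynomial.eval_X]

theorem eval_zero_polyaP (ω : ℝ → ℝ) (l : ℕ) :
    (polyaP ω l).eval 0 = (-1) ^ l * mellinAt ω (l + 1) / mellinAt ω 1 := by
  rw [eval_polyaP, Finset.sum_range_succ', Finset.sum_eq_zero fun j _ => by simp]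
  simp
  ring

theorem IsPolyaWeight.monic_polyaP (h : IsPolyaWeight n ω) {l : ℕ} (hl : l < n) :
    (polyaP ω l).Monic ∧ (polyaP ω l).natDegree = l := by
  obtain ⟨r, hr, hlow⟩ : ∃ r : Polynomial ℝ, r.degree < (l : WithBot ℕ) ∧
      polyaP ω l = Polynomial.X ^ l + r := by
    refine ⟨_, ?_, by rw [polyaP_eq, Finset.sum_range_succ, add_comm, Nat.sub_self,
      div_self (h.mellin_ne_zero l hl), Nat.choose_self, pow_zero, Nat.cast_one, one_mul,
      one_mul, Polynomial.C_1, one_mul]⟩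
    refine Polynomial.mem_degreeLT.1 (Submodule.sum_mem _ fun j hj => Polynomial.mem_degreeLT.2 ?_)
    exact (Polynomial.degree_C_mul_X_pow_le _ _).trans_lt
      (by exact_mod_cast Finset.mem_range.1 hj)
  rw [hlow]
  refine ⟨Polynomial.monic_X_pow_add hr, ?_⟩
  rw [Polynomial.natDegree_add_eq_left_of_degree_lt (by rwa [Polynomial.degree_X_pow]),
    Polynomial.natDegree_X_pow]

theorem IsPolyaWeight.sum_weightDeriv (h : IsPolyaWeight n ω) {b : ℕ} (hb : b ≤ n - 1)
    (hy : 0 < y) (hd : DifferentiableAt ℝ (iteratedDeriv (n - 2) ω) y) :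
    ∑ j ∈ Finset.range (b + 1), weightDeriv ω j j y / (j ! : ℝ) =
      weightDeriv ω b (b + 1) y / ((b ! : ℝ) * y) := by
  induction b with
  | zero =>
    simp only [weightDeriv, zero_add, Finset.range_one, Finset.sum_singleton, iteratedDeriv_zero,
      pow_zero, one_mul, Nat.factorial_zero, Nat.cast_one, div_one, pow_one]
    rw [mul_div_cancel_left₀ _ hy.ne']
  | succ b ih =>
    have hb' : b ≤ n - 2 := by omega
    rw [Finset.sum_range_succ, ih (by omega), h.weightDeriv_succ_succ (m := b + 1) hb' hy hd,
      Nat.factorial_succ, Nat.cast_mul, Nat.cast_succ]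
    field_simp
    ring

theorem IsPolyaWeight.polyaKernel_zero (h : IsPolyaWeight n ω) (y : ℝ) :
    polyaKernel n ω 0 y =
      1 / mellinAt ω 1 * ∑ j ∈ Finset.range n, weightDeriv ω j j y / (j ! : ℝ) := by
  rw [polyaKernel, kernel, Finset.mul_sum]
  refine Finset.sum_congr rfl fun j hj => ?_
  have hsign : (-1 : ℝ) ^ j * (-1) ^ j = 1 := pow_mul_pow_eq_one j (by norm_num)
  rw [eval_zero_polyaP, polyaQ_eq]
  calc (-1) ^ j * mellinAt ω (j + 1) / mellinAt ω 1 *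
        ((-1) ^ j / ((j ! : ℝ) * mellinAt ω (j + 1)) * weightDeriv ω j j y)
      = ((-1 : ℝ) ^ j * (-1) ^ j) * (mellinAt ω (j + 1) / mellinAt ω (j + 1)) *
          (1 / mellinAt ω 1 * (weightDeriv ω j j y / (j ! : ℝ))) := by ring
    _ = 1 / mellinAt ω 1 * (weightDeriv ω j j y / (j ! : ℝ)) := by
      rw [hsign, div_self (h.mellin_ne_zero j (Finset.mem_range.1 hj)), one_mul,
        one_mul]

theorem IsPolyaWeight.polyaKernel_zero_eq (h : IsPolyaWeight n ω) (hn : 0 < n) (hy : 0 < y)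
    (hd : DifferentiableAt ℝ (iteratedDeriv (n - 2) ω) y) :
    polyaKernel n ω 0 y =
      1 / (((n - 1)! : ℝ) * mellinAt ω 1) * (1 / y) * weightDeriv ω (n - 1) n y := by
  have hsum := h.sum_weightDeriv (b := n - 1) le_rfl hy hd
  rw [Nat.sub_add_cancel hn] at hsum
  rw [h.polyaKernel_zero, hsum]
  ring

end Kernel

section Biorthonormality

variable {n : ℕ} {ω : ℝ → ℝ} {a b : ℕ}

theorem mellinAt_natCast_add_one (ω : ℝ → ℝ) (a : ℕ) :
    mellinAt ω (a + 1) = ∫ x in Ioi (0 : ℝ), x ^ a * ω x := by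
  simp only [mellinAt, add_sub_cancel_right, Real.rpow_natCast]

theorem IsPolyaWeight.integrableOn_pow_mul_weightDeriv (h : IsPolyaWeight n ω) (ha : a < n)
    (hb : b < n) : IntegrableOn (fun y => y ^ a * weightDeriv ω b b y) (Ioi 0) :=
  h.integrableOn a ha b hb

theorem IsPolyaWeight.integrableOn_weight (h : IsPolyaWeight n ω) (hn : 0 < n) :
    IntegrableOn ω (Ioi 0) := by
  simpa [weightDeriv] using h.integrableOn_pow_mul_weightDeriv hn hn

theorem IsPolyaWeight.integral_pow_mul_weightDeriv_succ (h : IsPolyaWeight n ω) (ha : a < n)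
    (hb : b + 1 < n) :
    ∫ y in Ioi (0 : ℝ), y ^ a * weightDeriv ω (b + 1) (b + 1) y =
      (b - a) * ∫ y in Ioi (0 : ℝ), y ^ a * weightDeriv ω b b y := by
  have hint := h.integrableOn_pow_mul_weightDeriv ha (b := b) (by omega)
  have hint' := h.integrableOn_pow_mul_weightDeriv ha hb
  have hrec : (fun y => y ^ (a + 1) * weightDeriv ω (b + 1) b y) =ᵐ[volume.restrict (Ioi 0)]
      fun y => y ^ a * weightDeriv ω (b + 1) (b + 1) y -
        (b + 1) * (y ^ a * weightDeriv ω b b y) := by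
    filter_upwards [ae_restrict_mem measurableSet_Ioi, ae_restrict_of_ae h.ae_differentiableAt]
      with y hy hd
    rw [h.weightDeriv_succ_succ (by omega) hy (hd hy)]
    ring
  have hderiv : ∀ y : ℝ, deriv (fun x : ℝ => x ^ (a + 1)) y * weightDeriv ω b b y =
      (a + 1) * (y ^ a * weightDeriv ω b b y) := fun y => by simp [mul_assoc]
  have hparts := (locallyACOnPos_of_contDiffOn
    (contDiff_id.pow (a + 1)).contDiffOn).integral_mul_deriv_eq_neg
    (h.locallyACOnPos_weightDeriv (b := b) (m := b) (by omega))
    (hint.congr_fun (fun y (hy : 0 < y) => by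
      simp only [id, pow_succ]
      field_simp) measurableSet_Ioi)
    (by
      rw [deriv_weightDeriv]
      exact (hint'.sub (hint.const_mul _)).congr hrec.symm)
    (by
      simp only [id, hderiv]
      exact hint.const_mul _)
  simp only [id, hderiv, deriv_weightDeriv] at hparts
  rw [integral_congr_ae hrec, integral_sub hint' (hint.const_mul _), integral_const_mul,
    integral_const_mul] at hparts
  linear_combination hparts

theorem IsPolyaWeight.integral_pow_mul_weightDeriv (h : IsPolyaWeight n ω) (ha : a < n)
    (hb : b < n) : ∫ y in Ioi (0 : ℝ), y ^ a * weightDeriv ω b b y =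
      (-1) ^ b * (a.descFactorial b : ℝ) * mellinAt ω (a + 1) := by
  induction b with
  | zero => simp [weightDeriv, mellinAt_natCast_add_one]
  | succ b ih =>
    rw [h.integral_pow_mul_weightDeriv_succ ha hb, ih (by omega), Nat.descFactorial_succ]
    rcases le_or_gt b a with hba | hba
    · push_cast [Nat.cast_sub hba]
      ring
    · simp [Nat.descFactorial_of_lt hba]

theorem IsPolyaWeight.integrableOn_pow_mul_polyaQ (h : IsPolyaWeight n ω) (ha : a < n)
    (hb : b < n) : IntegrableOn (fun y => y ^ a * polyaQ ω b y) (Ioi 0) := by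
  simp only [polyaQ_eq, mul_left_comm _ (_ / _)]
  exact (h.integrableOn_pow_mul_weightDeriv ha hb).const_mul _

theorem IsPolyaWeight.integral_pow_mul_polyaQ (h : IsPolyaWeight n ω) (ha : a < n)
    (hb : b < n) : ∫ y in Ioi (0 : ℝ), y ^ a * polyaQ ω b y =
      (a.choose b : ℝ) * mellinAt ω (a + 1) / mellinAt ω (b + 1) := by
  have hfact : (b ! : ℝ) ≠ 0 := by positivity
  have hsign : (-1 : ℝ) ^ b * (-1) ^ b = 1 := pow_mul_pow_eq_one b (by norm_num)
  simp only [polyaQ_eq, mul_left_comm _ (_ / _)]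
  rw [integral_const_mul, h.integral_pow_mul_weightDeriv ha hb,
    Nat.descFactorial_eq_factorial_mul_choose, Nat.cast_mul]
  calc (-1) ^ b / ((b ! : ℝ) * mellinAt ω (b + 1)) *
        ((-1) ^ b * ((b ! : ℝ) * (a.choose b : ℝ)) * mellinAt ω (a + 1))
      = ((-1 : ℝ) ^ b * (-1) ^ b) * ((b ! : ℝ) / (b ! : ℝ)) *
          ((a.choose b : ℝ) * mellinAt ω (a + 1) / mellinAt ω (b + 1)) := by ring
    _ = (a.choose b : ℝ) * mellinAt ω (a + 1) / mellinAt ω (b + 1) := by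
      rw [hsign, div_self hfact, one_mul, one_mul]

-- Compare coefficients of `X ^ b` in the binomial expansion of `X ^ a = ((X + 1) - 1) ^ a`.
theorem sum_neg_one_pow_mul_choose_mul_choose {R : Type*} [CommRing R] (a b : ℕ) :
    ∑ j ∈ Finset.range (a + 1), (-1 : R) ^ (a - j) * (a.choose j : R) * (j.choose b : R) =
      if a = b then 1 else 0 := by
  have hexpand : (Polynomial.X ^ a : Polynomial R) = ∑ j ∈ Finset.range (a + 1),
      Polynomial.C ((-1 : R) ^ (a - j) * (a.choose j : R)) * (Polynomial.X + 1) ^ j := by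
    conv_lhs => rw [← add_neg_cancel_right (Polynomial.X : Polynomial R) 1, add_pow]
    refine Finset.sum_congr rfl fun j _ => ?_
    simp only [Polynomial.C_mul, Polynomial.C_pow, Polynomial.C_neg, Polynomial.C_1, map_natCast]
    ring
  have hcoeff := congrArg (Polynomial.coeff · b) hexpand
  simp only [Polynomial.coeff_X_pow, Polynomial.finsetSum_coeff, Polynomial.coeff_C_mul,
    Polynomial.coeff_X_add_one_pow] at hcoeff
  simp only [← hcoeff, eq_comm]

theorem IsPolyaWeight.isBiorthonormal (h : IsPolyaWeight n ω) :
    IsBiorthonormal n (polyaP ω) (polyaQ ω) := by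
  refine ⟨fun j hj => h.monic_polyaP hj, fun a ha b hb => ?_⟩
  have hlt : ∀ j ∈ Finset.range (a + 1), j < n := fun j hj => by
    rw [Finset.mem_range] at hj
    omega
  have hint : ∀ j ∈ Finset.range (a + 1), IntegrableOn (fun x => mellinAt ω (a + 1) /
      mellinAt ω (j + 1) * ((-1) ^ (a - j) * (a.choose j : ℝ)) * (x ^ j * polyaQ ω b x)) (Ioi 0) :=
    fun j hj => (h.integrableOn_pow_mul_polyaQ (hlt j hj) hb).const_mul _
  simp only [eval_polyaP, Finset.sum_mul, mul_assoc _ (_ ^ _) (polyaQ ω b _)]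
  refine ⟨integrable_finsetSum _ hint, ?_⟩
  calc ∫ x in Ioi (0 : ℝ), ∑ j ∈ Finset.range (a + 1), mellinAt ω (a + 1) /
        mellinAt ω (j + 1) * ((-1) ^ (a - j) * (a.choose j : ℝ)) * (x ^ j * polyaQ ω b x)
      = ∑ j ∈ Finset.range (a + 1), mellinAt ω (a + 1) / mellinAt ω (j + 1) *
          ((-1) ^ (a - j) * (a.choose j : ℝ)) *
          ((j.choose b : ℝ) * mellinAt ω (j + 1) / mellinAt ω (b + 1)) := by
        rw [integral_finsetSum _ hint]
        exact Finset.sum_congr rfl fun j hj => by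
          rw [integral_const_mul, h.integral_pow_mul_polyaQ (hlt j hj) hb]
    _ = mellinAt ω (a + 1) / mellinAt ω (b + 1) * ∑ j ∈ Finset.range (a + 1),
          (-1) ^ (a - j) * (a.choose j : ℝ) * (j.choose b : ℝ) := by
        rw [Finset.mul_sum]
        refine Finset.sum_congr rfl fun j hj => ?_
        have := h.mellin_ne_zero j (hlt j hj)
        field_simp
    _ = if a = b then 1 else 0 := by
        rw [sum_neg_one_pow_mul_choose_mul_choose]
        split_ifs with hab
        · rw [hab, div_self (h.mellin_ne_zero b hb), one_mul]
        · rw [mul_zero]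

end Biorthonormality

section Stieltjes

variable {n : ℕ} {ω : ℝ → ℝ} {b : ℕ} {z : ℝ}

theorem integrableOn_div_add_pow_mul {f : ℝ → ℝ} (hf : IntegrableOn f (Ioi 0)) (hz : 0 ≤ z)
    (k : ℕ) : IntegrableOn (fun y => (y / (y + z)) ^ k * f y) (Ioi 0) := by
  refine hf.bdd_mul (c := 1) (Measurable.aestronglyMeasurable (by fun_prop)) ?_
  filter_upwards [ae_restrict_mem measurableSet_Ioi] with y (hy : 0 < y)
  have hle : y / (y + z) ≤ 1 := div_le_one_of_le₀ (by linarith) (by linarith)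
  rw [Real.norm_of_nonneg (by positivity)]
  exact pow_le_one₀ (by positivity) hle

theorem hasDerivAt_inv_add_pow {y : ℝ} (hy : y + z ≠ 0) (k : ℕ) :
    HasDerivAt (fun x : ℝ => ((x + z) ^ (k + 1))⁻¹) (-(k + 1) * ((y + z) ^ (k + 2))⁻¹) y := by
  refine ((((hasDerivAt_id y).add_const z).pow (k + 1)).inv (pow_ne_zero _ hy)).congr_deriv ?_
  simp only [id, Pi.pow_apply, Nat.add_sub_cancel]
  push_cast
  field_simp
  ring

theorem locallyACOnPos_inv_add_pow (hz : 0 ≤ z) (k : ℕ) :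
    LocallyACOnPos fun x => ((x + z) ^ k)⁻¹ :=
  locallyACOnPos_of_contDiffOn <| ContDiffOn.inv (by fun_prop) fun x (hx : 0 < x) => by positivity

theorem IsPolyaWeight.integrableOn_weightDeriv_div_pow (h : IsPolyaWeight n ω) (hb : b < n)
    (k : ℕ) : IntegrableOn (fun y => weightDeriv ω b (b + k) y / y ^ k) (Ioi 0) := by
  induction b generalizing k with
  | zero =>
    refine (h.integrableOn_weight hb).congr_fun (fun y hy => ?_) measurableSet_Ioi
    have hpow : y ^ k ≠ 0 := pow_ne_zero k (ne_of_gt hy)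
    simp only [weightDeriv, zero_add, iteratedDeriv_zero, mul_div_cancel_left₀ _ hpow]
  | succ b ihb =>
    induction k with
    | zero => simpa using h.integrableOn_pow_mul_weightDeriv (a := 0) (by omega) hb
    | succ k ihk =>
      refine (ihk.add ((ihb (by omega) (k + 1)).const_mul (b + 1 : ℝ))).congr ?_
      filter_upwards [ae_restrict_mem measurableSet_Ioi, ae_restrict_of_ae h.ae_differentiableAt]
        with y hy hd
      have hne : y ≠ 0 := ne_of_gt hy
      have hrec := h.weightDeriv_succ_succ (b := b) (m := b + 1 + k) (by omega) hy (hd hy)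
      simp only [Pi.add_apply, ← add_assoc, hrec, add_right_comm b k 1]
      field_simp
      ring

theorem IsPolyaWeight.integral_inv_add_pow_mul_weightDeriv_succ (h : IsPolyaWeight n ω)
    (hb : b + 1 < n) (hz : 0 ≤ z) (k : ℕ) :
    ∫ y in Ioi (0 : ℝ), ((y + z) ^ (k + 1))⁻¹ * weightDeriv ω (b + 1) (b + (k + 2)) y =
      (k + 1) * ∫ y in Ioi (0 : ℝ), ((y + z) ^ (k + 2))⁻¹ * weightDeriv ω b (b + (k + 2)) y := by
  have hderiv : EqOn (fun y => deriv (fun x => ((x + z) ^ (k + 1))⁻¹) y *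
      weightDeriv ω b (b + (k + 2)) y) (fun y => -(k + 1) *
      (((y + z) ^ (k + 2))⁻¹ * weightDeriv ω b (b + (k + 2)) y)) (Ioi 0) := fun y hy => by
    have hyz : y + z ≠ 0 := (add_pos_of_pos_of_nonneg hy hz).ne'
    simp only [(hasDerivAt_inv_add_pow hyz k).deriv, mul_assoc]
  have hlow := h.integrableOn_weightDeriv_div_pow (b := b) (by omega) (k + 2)
  have hupp := h.integrableOn_weightDeriv_div_pow hb (k + 1)
  rw [show b + 1 + (k + 1) = b + (k + 2) by omega] at hupp
  have hparts := (locallyACOnPos_inv_add_pow hz (k + 1)).integral_mul_deriv_eq_neg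
    (h.locallyACOnPos_weightDeriv (b := b) (m := b + (k + 2)) (by omega))
    ((integrableOn_div_add_pow_mul hlow hz (k + 1)).congr_fun (fun y (hy : 0 < y) => by
      simp only [div_pow]
      field_simp
      ring) measurableSet_Ioi)
    ((integrableOn_div_add_pow_mul hupp hz (k + 1)).congr_fun (fun y (hy : 0 < y) => by
      simp only [deriv_weightDeriv, div_pow]
      field_simp) measurableSet_Ioi)
    (((integrableOn_div_add_pow_mul hlow hz (k + 2)).const_mul (-(k + 1 : ℝ))).congr <| by
      filter_upwards [ae_restrict_mem measurableSet_Ioi] with y (hy : 0 < y)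
      have hterm := hderiv hy
      simp only at hterm
      rw [hterm, div_pow]
      field_simp)
  rw [setIntegral_congr_fun measurableSet_Ioi hderiv, integral_const_mul, deriv_weightDeriv]
    at hparts
  rw [hparts]
  ring

theorem IsPolyaWeight.integral_inv_add_pow_mul_weightDeriv (h : IsPolyaWeight n ω)
    (hb : b < n) (hz : 0 ≤ z) (k : ℕ) :
    ∫ y in Ioi (0 : ℝ), ((y + z) ^ (k + 1))⁻¹ * weightDeriv ω b (b + k + 1) y =
      ((k + 1).ascFactorial b : ℝ) * ∫ y in Ioi (0 : ℝ), (y / (y + z)) ^ (b + k + 1) * ω y := by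
  induction b generalizing k with
  | zero =>
    simp only [weightDeriv, iteratedDeriv_zero, Nat.ascFactorial_zero, Nat.cast_one, one_mul,
      zero_add, div_pow]
    congr 1 with y
    ring
  | succ b ih =>
    rw [show b + 1 + k + 1 = b + (k + 2) by omega,
      h.integral_inv_add_pow_mul_weightDeriv_succ hb hz, Nat.ascFactorial_succ,
      ← Nat.succ_ascFactorial (k + 1) b, Nat.cast_mul, Nat.cast_succ, mul_assoc]
    exact congrArg _ (ih (by omega) (k + 1))

theorem IsPolyaWeight.integral_div_add_mul_polyaKernel (h : IsPolyaWeight n ω) (hn : 0 < n)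
    (hz : 0 ≤ z) :
    ∫ y in Ioi (0 : ℝ), y / (y + z) * polyaKernel n ω 0 y =
      1 / mellinAt ω 1 * ∫ y in Ioi (0 : ℝ), (y / (y + z)) ^ n * ω y := by
  have hstieltjes := h.integral_inv_add_pow_mul_weightDeriv (b := n - 1) (by omega) hz 0
  simp only [Nat.add_zero, zero_add, Nat.sub_add_cancel hn, Nat.one_ascFactorial, pow_one]
    at hstieltjes
  have hfact : ((n - 1)! : ℝ) ≠ 0 := by positivity
  calc ∫ y in Ioi (0 : ℝ), y / (y + z) * polyaKernel n ω 0 y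
      = ∫ y in Ioi (0 : ℝ), 1 / (((n - 1)! : ℝ) * mellinAt ω 1) *
          ((y + z)⁻¹ * weightDeriv ω (n - 1) n y) := by
        refine integral_congr_ae ?_
        filter_upwards [ae_restrict_mem measurableSet_Ioi,
          ae_restrict_of_ae h.ae_differentiableAt] with y hy hd
        have hne : y ≠ 0 := ne_of_gt hy
        rw [h.polyaKernel_zero_eq hn hy (hd hy)]
        field_simp
    _ = 1 / mellinAt ω 1 * ∫ y in Ioi (0 : ℝ), (y / (y + z)) ^ n * ω y := by
        rw [integral_const_mul, hstieltjes]
        field_simp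

end Stieltjes

section Determinants

variable {ι R : Type*} [Fintype ι] [DecidableEq ι] [CommRing R]

theorem det_mul_det_eq_sum_sum (A B : Matrix ι ι R) :
    A.det * B.det = ∑ σ : Equiv.Perm ι, ∑ τ : Equiv.Perm ι,
      (Equiv.Perm.sign σ : R) * (Equiv.Perm.sign τ : R) * ∏ a, (A a (σ a) * B a (τ a)) := by
  rw [← A.det_transpose, ← B.det_transpose, Matrix.det_apply', Matrix.det_apply',
    Finset.sum_mul_sum]
  refine Finset.sum_congr rfl fun σ _ => Finset.sum_congr rfl fun τ _ => ?_
  simp only [Matrix.transpose_apply, Finset.prod_mul_distrib]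
  ring

theorem sum_sum_sign_mul_sign_mul_prod (M : Matrix ι ι R) :
    ∑ σ : Equiv.Perm ι, ∑ τ : Equiv.Perm ι,
      (Equiv.Perm.sign σ : R) * (Equiv.Perm.sign τ : R) * ∏ a, M (σ a) (τ a) =
      ((Fintype.card ι)! : R) * M.det := by
  have hrow : ∀ σ : Equiv.Perm ι, ∑ τ : Equiv.Perm ι,
      (Equiv.Perm.sign σ : R) * (Equiv.Perm.sign τ : R) * ∏ a, M (σ a) (τ a) = M.det := fun σ => by
    have hperm := M.det_permute σ
    rw [← Matrix.det_transpose, Matrix.det_apply'] at hperm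
    simp only [Matrix.transpose_apply, Matrix.submatrix_apply, id] at hperm
    simp only [mul_assoc, ← Finset.mul_sum, hperm]
    rw [← mul_assoc, ← Int.cast_mul, ← Units.val_mul, Int.units_mul_self, Units.val_one,
      Int.cast_one, one_mul]
  simp only [hrow, Finset.sum_const, Finset.card_univ, Fintype.card_perm, nsmul_eq_mul]

theorem det_eq_of_col_zero_of_one {m : ℕ} (B : Matrix (Fin (m + 1)) (Fin (m + 1)) R)
    (c : Fin m → R) (hcol : ∀ i : Fin m, B i.succ 0 = -c i)
    (hone : ∀ i j : Fin m, B i.succ j.succ = if i = j then 1 else 0) :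
    B.det = B 0 0 + ∑ i, c i * B 0 i.succ := by
  have hupdate := Matrix.det_updateCol_sum B 0 (Fin.cons 1 c)
  rw [Fin.cons_zero, one_smul] at hupdate
  have hminor : (B.updateCol 0 fun k => ∑ i, (Fin.cons 1 c : Fin (m + 1) → R) i • B k i).submatrix
      (Fin.succAbove 0) Fin.succ = 1 := by
    ext i j
    simp [hone, Matrix.one_apply]
  rw [← hupdate, Matrix.det_succ_column_zero, Fin.sum_univ_succ, Finset.sum_eq_zero, add_zero,
    hminor]
  · simp [Fin.sum_univ_succ]
  · intro i _
    simp [Fin.sum_univ_succ, hcol, hone]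

end Determinants

section Andreief

variable {ι α 𝕜 : Type*} [Fintype ι] [RCLike 𝕜] [MeasurableSpace α]
  {μ : Measure α} [SigmaFinite μ] {f g : ι → α → 𝕜}

theorem integrable_prod_mul (h : ∀ i j, Integrable (fun y => f i y * g j y) μ)
    (σ τ : Equiv.Perm ι) :
    Integrable (fun x : ι → α => ∏ a, (f (σ a) (x a) * g (τ a) (x a))) (Measure.pi fun _ => μ) :=
  Integrable.fintype_prod (f := fun a y => f (σ a) y * g (τ a) y) fun a => h (σ a) (τ a)

variable [DecidableEq ι]

theorem integrable_det_mul_det (h : ∀ i j, Integrable (fun y => f i y * g j y) μ) :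
    Integrable (fun x : ι → α => (Matrix.of fun a i => f i (x a)).det *
      (Matrix.of fun a j => g j (x a)).det) (Measure.pi fun _ => μ) := by
  simp only [det_mul_det_eq_sum_sum]
  exact integrable_finsetSum _ fun σ _ => integrable_finsetSum _ fun τ _ =>
    (integrable_prod_mul h σ τ).const_mul _

/-- Andréief's identity. -/
theorem integral_det_mul_det (h : ∀ i j, Integrable (fun y => f i y * g j y) μ) :
    ∫ x : ι → α, (Matrix.of fun a i => f i (x a)).det *
      (Matrix.of fun a j => g j (x a)).det ∂(Measure.pi fun _ => μ) =
      ((Fintype.card ι)! : 𝕜) * (Matrix.of fun i j => ∫ y, f i y * g j y ∂μ).det := by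
  have hint := fun σ τ : Equiv.Perm ι => (integrable_prod_mul h σ τ).const_mul
    ((Equiv.Perm.sign σ : 𝕜) * (Equiv.Perm.sign τ : 𝕜))
  simp only [det_mul_det_eq_sum_sum, ← sum_sum_sign_mul_sign_mul_prod, Matrix.of_apply]
  rw [integral_finsetSum _ fun σ _ => integrable_finsetSum _ fun τ _ => hint σ τ]
  refine Finset.sum_congr rfl fun σ _ => ?_
  rw [integral_finsetSum _ fun τ _ => hint σ τ]
  refine Finset.sum_congr rfl fun τ _ => ?_
  rw [integral_const_mul]
  exact congrArg _
    (integral_fintype_prod_eq_prod (μ := fun _ => μ) fun a y => f (σ a) y * g (τ a) y)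

end Andreief

section PolynomialEnsemble

variable {n : ℕ} {p : ℕ → Polynomial ℝ} {q : ℕ → ℝ → ℝ}

theorem orthantVolume_eq_pi (n : ℕ) :
    orthantVolume n = Measure.pi fun _ : Fin n => volume.restrict (Ioi (0 : ℝ)) := by
  rw [← Measure.restrict_pi_pi, orthantVolume]
  congr 1
  ext Λ
  simp

theorem ae_orthantVolume_pos (n : ℕ) : ∀ᵐ Λ ∂(orthantVolume n), ∀ i, 0 < Λ i := by
  have hmeas : MeasurableSet {Λ : Fin n → ℝ | ∀ i, 0 < Λ i} := by
    rw [show {Λ : Fin n → ℝ | ∀ i, 0 < Λ i} = univ.pi fun _ => Ioi 0 by ext; simp]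
    exact MeasurableSet.univ_pi fun _ => measurableSet_Ioi
  exact ae_restrict_mem hmeas

theorem IsBiorthonormal.integrable_eigenDensity (h : IsBiorthonormal n p q) :
    Integrable (eigenDensity n q) (orthantVolume n) := by
  have hdet := (integrable_det_mul_det (μ := volume.restrict (Ioi (0 : ℝ)))
    (f := fun i : Fin n => (p i).eval) (g := fun j => q j)
    fun i j => (h.2 i i.2 j j.2).1).const_mul (1 / (n ! : ℝ))
  rw [orthantVolume_eq_pi]
  refine hdet.congr (Filter.Eventually.of_forall fun Λ => ?_)
  simp only
  rw [← Matrix.det_eval_matrixOfPolynomials_eq_det_vandermonde Λ (fun i => p i)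
    (fun i => (h.1 i i.2).2) fun i => (h.1 i i.2).1, eigenDensity, mul_assoc]

theorem IsBiorthonormal.zero_eq_one (h : IsBiorthonormal n p q) (hn : 0 < n) : p 0 = 1 :=
  (h.1 0 hn).1.natDegree_eq_zero.1 (h.1 0 hn).2

theorem IsBiorthonormal.integrableOn_right (h : IsBiorthonormal n p q) {j : ℕ} (hj : j < n) :
    IntegrableOn (q j) (Ioi 0) := by
  simpa [h.zero_eq_one (Nat.zero_lt_of_lt hj)] using (h.2 0 (Nat.zero_lt_of_lt hj) j hj).1

theorem IsBiorthonormal.integral_right (h : IsBiorthonormal n p q) {j : ℕ} (hj : j < n) :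
    ∫ y in Ioi (0 : ℝ), q j y = if 0 = j then 1 else 0 := by
  simpa [h.zero_eq_one (Nat.zero_lt_of_lt hj)] using (h.2 0 (Nat.zero_lt_of_lt hj) j hj).2

theorem IsBiorthonormal.integrableOn_sub_eval_zero_mul (h : IsBiorthonormal n p q) {i j : ℕ}
    (hi : i < n) (hj : j < n) :
    IntegrableOn (fun y => ((p i).eval y - (p i).eval 0) * q j y) (Ioi 0) := by
  simp only [sub_mul]
  exact (h.2 i hi j hj).1.sub ((h.integrableOn_right hj).const_mul _)

theorem IsBiorthonormal.integral_sub_eval_zero_mul (h : IsBiorthonormal n p q) {i j : ℕ}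
    (hi : i < n) (hj : j < n) :
    ∫ y in Ioi (0 : ℝ), ((p i).eval y - (p i).eval 0) * q j y =
      (if i = j then 1 else 0) - (p i).eval 0 * if 0 = j then 1 else 0 := by
  simp only [sub_mul]
  rw [integral_sub (h.2 i hi j hj).1 ((h.integrableOn_right hj).const_mul _), integral_const_mul,
    (h.2 i hi j hj).2, h.integral_right hj]

/-- For `p` of positive degree, the polynomial `r` with `x r(x) = (x + z) (p(x) - p(0))`, which is
monic of the same degree when `p` is. It turns `∏ x / (x + z)` times a Vandermonde determinant into
a determinant in the functions `p(x) - p(0)`. -/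
noncomputable def shiftedPoly (z : ℝ) (p : Polynomial ℝ) : Polynomial ℝ :=
  if p.natDegree = 0 then p else (Polynomial.X + Polynomial.C z) * p.divX

theorem monic_shiftedPoly {r : Polynomial ℝ} (hr : r.Monic) (z : ℝ) :
    (shiftedPoly z r).Monic ∧ (shiftedPoly z r).natDegree = r.natDegree := by
  rw [shiftedPoly]
  split_ifs with hdeg
  · exact ⟨hr, rfl⟩
  have hdivX := r.natDegree_divX_eq_natDegree_tsub_one
  have hmonic : r.divX.Monic := by
    rw [Polynomial.Monic, Polynomial.leadingCoeff, hdivX, Polynomial.coeff_divX,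
      Nat.sub_add_cancel (Nat.pos_of_ne_zero hdeg)]
    exact hr
  refine ⟨(Polynomial.monic_X_add_C z).mul hmonic, ?_⟩
  rw [(Polynomial.monic_X_add_C z).natDegree_mul hmonic, hdivX, Polynomial.natDegree_X_add_C]
  omega

theorem div_add_mul_eval_shiftedPoly {r : Polynomial ℝ} (hr : r.natDegree ≠ 0) {x z : ℝ}
    (hxz : x + z ≠ 0) : x / (x + z) * (shiftedPoly z r).eval x = r.eval x - r.eval 0 := by
  have hdivX := congrArg (Polynomial.eval x) (Polynomial.divX_mul_X_add r)
  rw [Polynomial.eval_add, Polynomial.eval_mul, Polynomial.eval_X, Polynomial.eval_C,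
    Polynomial.coeff_zero_eq_eval_zero] at hdivX
  rw [shiftedPoly, if_neg hr, ← hdivX, Polynomial.eval_mul, Polynomial.eval_add, Polynomial.eval_X,
    Polynomial.eval_C]
  field_simp
  ring

/-- The functions whose determinant is `∏ x / (x + z)` times the Vandermonde determinant:
`x / (x + z), p_1(x) - p_1(0), p_2(x) - p_2(0), …`. -/
noncomputable def shiftedFun (z : ℝ) (p : ℕ → Polynomial ℝ) (i : ℕ) (x : ℝ) : ℝ :=
  if i = 0 then x / (x + z) else (p i).eval x - (p i).eval 0

theorem IsBiorthonormal.det_shiftedFun (h : IsBiorthonormal n p q) {z : ℝ} {Λ : Fin n → ℝ}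
    (hΛ : ∀ a, Λ a + z ≠ 0) :
    (Matrix.of fun a i : Fin n => shiftedFun z p i (Λ a)).det =
      (∏ a, (Λ a / (Λ a + z))) * (Matrix.vandermonde Λ).det := by
  rw [Matrix.det_eval_matrixOfPolynomials_eq_det_vandermonde Λ
    (fun i : Fin n => shiftedPoly z (p i))
    (fun i => (monic_shiftedPoly (h.1 i i.2).1 z).2.trans (h.1 i i.2).2)
    (fun i => (monic_shiftedPoly (h.1 i i.2).1 z).1), ← Matrix.det_mul_column]
  congr 1
  ext a i
  simp only [Matrix.of_apply, shiftedFun]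
  split_ifs with hi
  · rw [hi, h.zero_eq_one i.pos, shiftedPoly, if_pos Polynomial.natDegree_one,
      Polynomial.eval_one, mul_one]
  · rw [div_add_mul_eval_shiftedPoly (by rwa [(h.1 i i.2).2]) (hΛ a)]

theorem IsBiorthonormal.integrableOn_shiftedFun_mul (h : IsBiorthonormal n p q) {z : ℝ}
    (hz : 0 ≤ z) (i j : Fin n) :
    IntegrableOn (fun y => shiftedFun z p i y * q j y) (Ioi 0) := by
  by_cases hi : (i : ℕ) = 0
  · simpa only [shiftedFun, if_pos hi, pow_one] using
      integrableOn_div_add_pow_mul (h.integrableOn_right j.2) hz 1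
  · simpa only [shiftedFun, if_neg hi] using h.integrableOn_sub_eval_zero_mul i.2 j.2

theorem IsBiorthonormal.integral_eigenDensity_mul_prod_eq_det (h : IsBiorthonormal n p q) {z : ℝ}
    (hz : 0 ≤ z) :
    ∫ Λ, eigenDensity n q Λ * ∏ a, (Λ a / (Λ a + z)) ∂(orthantVolume n) =
      (Matrix.of fun i j : Fin n => ∫ y in Ioi (0 : ℝ), shiftedFun z p i y * q j y).det := by
  calc ∫ Λ, eigenDensity n q Λ * ∏ a, (Λ a / (Λ a + z)) ∂(orthantVolume n)
      = ∫ Λ, 1 / (n ! : ℝ) * ((Matrix.of fun a i : Fin n => shiftedFun z p i (Λ a)).det *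
          (Matrix.of fun a j : Fin n => q j (Λ a)).det) ∂(orthantVolume n) := by
        refine integral_congr_ae ?_
        filter_upwards [ae_orthantVolume_pos n] with Λ hΛ
        rw [h.det_shiftedFun fun a => (add_pos_of_pos_of_nonneg (hΛ a) hz).ne', eigenDensity]
        ring
    _ = (Matrix.of fun i j : Fin n => ∫ y in Ioi (0 : ℝ), shiftedFun z p i y * q j y).det := by
        rw [integral_const_mul, orthantVolume_eq_pi,
          integral_det_mul_det (f := fun i : Fin n => shiftedFun z p i) (g := fun j : Fin n => q j)
          (h.integrableOn_shiftedFun_mul hz), Fintype.card_fin, ← mul_assoc,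
          one_div_mul_cancel (by positivity), one_mul]

theorem IsBiorthonormal.integral_eigenDensity_mul_prod (h : IsBiorthonormal n p q) (hn : 0 < n)
    {z : ℝ} (hz : 0 ≤ z) :
    ∫ Λ, eigenDensity n q Λ * ∏ a, (Λ a / (Λ a + z)) ∂(orthantVolume n) =
      ∫ y in Ioi (0 : ℝ), y / (y + z) * kernel n p q 0 y := by
  obtain ⟨m, rfl⟩ : ∃ m, n = m + 1 := ⟨n - 1, by omega⟩
  have hint : ∀ j ∈ Finset.range (m + 1), IntegrableOn
      (fun y => (p j).eval 0 * (y / (y + z) * q j y)) (Ioi 0) := fun j hj => by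
    have hdiv : IntegrableOn (fun y => y / (y + z) * q j y) (Ioi 0) := by
      simpa only [pow_one] using
        integrableOn_div_add_pow_mul (h.integrableOn_right (Finset.mem_range.1 hj)) hz 1
    exact hdiv.const_mul _
  rw [h.integral_eigenDensity_mul_prod_eq_det hz,
    det_eq_of_col_zero_of_one _ fun i : Fin m => (p (i + 1)).eval 0]
  · simp only [kernel, Finset.mul_sum, mul_left_comm _ (Polynomial.eval _ _)]
    rw [integral_finsetSum _ hint, Finset.sum_range_succ', add_comm, Finset.sum_range]
    simp only [Matrix.of_apply, shiftedFun, Fin.val_zero, Fin.val_succ, if_true,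
      integral_const_mul, h.zero_eq_one hn, Polynomial.eval_one, one_mul]
  · intro i
    simp only [Matrix.of_apply, shiftedFun, Fin.val_zero, Fin.val_succ, Nat.succ_ne_zero, if_false]
    rw [h.integral_sub_eval_zero_mul (i := i + 1) (by omega) hn]
    simp
  · intro i j
    simp only [Matrix.of_apply, shiftedFun, Fin.val_succ, Nat.succ_ne_zero, if_false]
    rw [h.integral_sub_eval_zero_mul (i := i + 1) (j := j + 1) (by omega) (by omega)]
    simp [Fin.ext_iff]

end PolynomialEnsemble

instance matrixSecondCountable {m n : Type*} [Countable m] [Countable n] :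
    SecondCountableTopology (Matrix m n ℂ) :=
  inferInstanceAs (SecondCountableTopology (m → n → ℂ))

instance unitaryGroupSecondCountable {n : Type*} [Fintype n] [DecidableEq n] :
    SecondCountableTopology (Matrix.unitaryGroup n ℂ) :=
  TopologicalSpace.Subtype.secondCountableTopology _

section WeightedNormSq

variable {ι : Type*} [Fintype ι]

/-- The weighted squared norm `∑ a_i |v_i|²`; `a = 1` gives the Hermitian norm, whereas the norm
instance on `ι → ℂ` is the supremum norm. -/
noncomputable def weightedNormSq (a : ι → ℝ) (v : ι → ℂ) : ℝ := ∑ i, a i * ‖v i‖ ^ 2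

theorem weightedNormSq_add (a b : ι → ℝ) (v : ι → ℂ) :
    weightedNormSq (a + b) v = weightedNormSq a v + weightedNormSq b v := by
  simp only [weightedNormSq, Pi.add_apply, add_mul, Finset.sum_add_distrib]

theorem weightedNormSq_const_mul (c : ℝ) (a : ι → ℝ) (v : ι → ℂ) :
    weightedNormSq (fun i => c * a i) v = c * weightedNormSq a v := by
  simp only [weightedNormSq, Finset.mul_sum, mul_assoc]

theorem weightedNormSq_const (c : ℝ) (v : ι → ℂ) :
    weightedNormSq (fun _ => c) v = c * weightedNormSq 1 v := by
  simpa only [Pi.one_apply, mul_one] using weightedNormSq_const_mul c 1 v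

theorem weightedNormSq_smul (a : ι → ℝ) (s : ℝ) (v : ι → ℂ) :
    weightedNormSq a ((s : ℂ) • v) = s ^ 2 * weightedNormSq a v := by
  rw [weightedNormSq, weightedNormSq, Finset.mul_sum]
  refine Finset.sum_congr rfl fun i _ => ?_
  rw [Pi.smul_apply, norm_smul, Complex.norm_real, mul_pow, Real.norm_eq_abs, sq_abs]
  ring

theorem weightedNormSq_nonneg {a : ι → ℝ} (ha : ∀ i, 0 ≤ a i) (v : ι → ℂ) :
    0 ≤ weightedNormSq a v :=
  Finset.sum_nonneg fun i _ => mul_nonneg (ha i) (by positivity)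

theorem weightedNormSq_pos {a : ι → ℝ} (ha : ∀ i, 0 < a i) {v : ι → ℂ} (hv : v ≠ 0) :
    0 < weightedNormSq a v := by
  obtain ⟨i, hi⟩ := Function.ne_iff.1 hv
  exact Finset.sum_pos' (fun j _ => mul_nonneg (ha j).le (by positivity))
    ⟨i, Finset.mem_univ i, mul_pos (ha i) (pow_pos (norm_pos_iff.2 hi) 2)⟩

theorem continuous_weightedNormSq (a : ι → ℝ) : Continuous (weightedNormSq a) := by
  unfold weightedNormSq
  fun_prop

theorem ofReal_weightedNormSq (a : ι → ℝ) (v : ι → ℂ) :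
    ((weightedNormSq a v : ℝ) : ℂ) = ∑ i, star (v i) * a i * v i := by
  simp only [weightedNormSq, Complex.ofReal_sum, Complex.ofReal_mul, Complex.sq_norm,
    Complex.normSq_eq_conj_mul_self, RCLike.star_def]
  exact Finset.sum_congr rfl fun i _ => by ring

theorem weightedNormSq_one_eq_norm_sq (v : ι → ℂ) :
    weightedNormSq 1 v = ‖WithLp.toLp 2 v‖ ^ 2 := by
  simp [EuclideanSpace.norm_sq_eq, weightedNormSq]

theorem weightedNormSq_one_eq_zero {v : ι → ℂ} : weightedNormSq 1 v = 0 ↔ v = 0 := by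
  simp [weightedNormSq_one_eq_norm_sq]

variable [DecidableEq ι]

theorem conjTranspose_mul_diagonal_mul_apply_self (B : Matrix ι ι ℂ) (d : ι → ℝ) (k : ι) :
    (Bᴴ * Matrix.diagonal (fun i => (d i : ℂ)) * B) k k =
      ((weightedNormSq d fun i => B i k : ℝ) : ℂ) := by
  rw [Matrix.mul_apply, ofReal_weightedNormSq]
  exact Finset.sum_congr rfl fun i _ => by
    rw [Matrix.mul_diagonal, Matrix.conjTranspose_apply]

theorem weightedNormSq_one_mulVec (U : Matrix.unitaryGroup ι ℂ) (v : ι → ℂ) :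
    weightedNormSq 1 (U.1 *ᵥ v) = weightedNormSq 1 v := by
  have hdot : ∀ w : ι → ℂ, ((weightedNormSq 1 w : ℝ) : ℂ) = star w ⬝ᵥ w := fun w => by
    simp [ofReal_weightedNormSq, dotProduct]
  rw [← Complex.ofReal_inj, hdot, hdot, Matrix.star_mulVec, ← Matrix.dotProduct_mulVec,
    Matrix.mulVec_mulVec, ← Matrix.star_eq_conjTranspose, Matrix.UnitaryGroup.star_mul_self,
    Matrix.one_mulVec]

theorem unitary_mulVec_ne_zero (U : Matrix.unitaryGroup ι ℂ) {v : ι → ℂ} (hv : v ≠ 0) :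
    U.1 *ᵥ v ≠ 0 := by
  rwa [Ne, ← weightedNormSq_one_eq_zero, weightedNormSq_one_mulVec, weightedNormSq_one_eq_zero]

theorem exists_unitary_eq_smul_mulVec_single (i₀ : ι) (v : ι → ℂ) :
    ∃ W : Matrix.unitaryGroup ι ℂ,
      v = ((‖WithLp.toLp 2 v‖ : ℝ) : ℂ) • (W.1 *ᵥ Pi.single i₀ 1) := by
  by_cases hv : v = 0
  · exact ⟨1, by simp [hv]⟩
  set r : ℝ := ‖WithLp.toLp 2 v‖
  have hr : r ≠ 0 := by simpa [r] using hv
  set w : EuclideanSpace ℂ ι := ((r⁻¹ : ℝ) : ℂ) • WithLp.toLp 2 v with hw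
  have hnorm : ‖w‖ = 1 := by
    rw [hw, norm_smul, Complex.norm_real, norm_inv, norm_norm, inv_mul_cancel₀ hr]
  obtain ⟨b, hb⟩ := Orthonormal.exists_orthonormalBasis_extension_of_card_eq (𝕜 := ℂ)
    (E := EuclideanSpace ℂ ι) (ι := ι) finrank_euclideanSpace (v := fun _ => w) (s := {i₀})
    ⟨fun _ => hnorm, fun i j hij => (hij (Subsingleton.elim i j)).elim⟩
  refine ⟨⟨(EuclideanSpace.basisFun ι ℂ).toBasis.toMatrix b,
    (EuclideanSpace.basisFun ι ℂ).toMatrix_orthonormalBasis_mem_unitary b⟩, ?_⟩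
  have hcol : (EuclideanSpace.basisFun ι ℂ).toBasis.toMatrix b *ᵥ Pi.single i₀ 1 =
      ((r⁻¹ : ℝ) : ℂ) • v := by
    ext i
    rw [Matrix.mulVec_single_one]
    simp [Module.Basis.toMatrix_apply, Matrix.col, hb i₀ rfl, hw]
  rw [hcol, smul_smul, ← Complex.ofReal_mul, mul_inv_cancel₀ hr, Complex.ofReal_one, one_smul]

theorem exists_unitary_eq_smul_mulVec (g : ι → ℂ) {v : ι → ℂ} (hv : v ≠ 0) :
    ∃ W : Matrix.unitaryGroup ι ℂ,
      g = ((‖WithLp.toLp 2 g‖ / ‖WithLp.toLp 2 v‖ : ℝ) : ℂ) • (W.1 *ᵥ v) := by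
  obtain ⟨i₀, -⟩ := Function.ne_iff.1 hv
  obtain ⟨V, hV⟩ := exists_unitary_eq_smul_mulVec_single i₀ v
  obtain ⟨W, hW⟩ := exists_unitary_eq_smul_mulVec_single i₀ g
  have hr : ‖WithLp.toLp 2 v‖ ≠ 0 := by simpa using hv
  have hVW : (W * V⁻¹).1 * V.1 = W.1 := by
    rw [← Submonoid.coe_mul, inv_mul_cancel_right]
  refine ⟨W * V⁻¹, ?_⟩
  have hv' : (W * V⁻¹).1 *ᵥ v = ((‖WithLp.toLp 2 v‖ : ℝ) : ℂ) • (W.1 *ᵥ Pi.single i₀ 1) := by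
    conv_lhs => rw [hV]
    rw [Matrix.mulVec_smul, Matrix.mulVec_mulVec, hVW]
  rw [hv', smul_smul, ← Complex.ofReal_mul, div_mul_cancel₀ _ hr]
  exact hW

end WeightedNormSq

section Gaussian

variable {ι : Type*} [Fintype ι]

theorem integrable_exp_neg_mul_norm_sq {b : ℝ} (hb : 0 < b) :
    Integrable fun z : ℂ => Real.exp (-b * ‖z‖ ^ 2) := by
  refine Integrable.of_integral_ne_zero ?_
  rw [GaussianFourier.integral_rexp_neg_mul_sq_norm hb]
  positivity

theorem lintegral_exp_neg_weightedNormSq {b : ι → ℝ} (hb : ∀ i, 0 < b i) :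
    ∫⁻ g : ι → ℂ, ENNReal.ofReal (Real.exp (-weightedNormSq b g)) =
      ENNReal.ofReal (∏ i, (Real.pi / b i)) := by
  have hprod : (fun g : ι → ℂ => Real.exp (-weightedNormSq b g)) =
      fun g => ∏ i, Real.exp (-b i * ‖g i‖ ^ 2) := by
    ext g
    simp only [← Real.exp_sum, weightedNormSq, ← Finset.sum_neg_distrib, neg_mul]
  have hint : Integrable fun g : ι → ℂ => Real.exp (-weightedNormSq b g) := by
    rw [hprod]
    exact Integrable.fintype_prod (f := fun i z => Real.exp (-b i * ‖z‖ ^ 2)) fun i =>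
      integrable_exp_neg_mul_norm_sq (hb i)
  rw [← ofReal_integral_eq_lintegral_ofReal hint
    (Filter.Eventually.of_forall fun g => (Real.exp_pos _).le), hprod,
    integral_fintype_prod_volume_eq_prod fun i (z : ℂ) => Real.exp (-b i * ‖z‖ ^ 2)]
  simp only [GaussianFourier.integral_rexp_neg_mul_sq_norm (V := ℂ) (hb _),
    Complex.finrank_real_complex]
  norm_num

theorem lintegral_exp_neg_mul_weightedNormSq_one {c : ℝ} (hc : 0 < c) :
    ∫⁻ g : ι → ℂ, ENNReal.ofReal (Real.exp (-(c * weightedNormSq 1 g))) =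
      ENNReal.ofReal ((Real.pi / c) ^ Fintype.card ι) := by
  simp only [← weightedNormSq_const, lintegral_exp_neg_weightedNormSq (ι := ι) fun _ => hc,
    Finset.prod_const, Finset.card_univ]

variable [DecidableEq ι]

theorem measurePreserving_unitary_mulVec (U : Matrix.unitaryGroup ι ℂ) :
    MeasurePreserving (fun g : ι → ℂ => U.1 *ᵥ g) := by
  have hnorm : ‖U.1.det‖ = 1 := CStarRing.norm_of_mem_unitary (Matrix.det_of_mem_unitary U.2)
  set T : (ι → ℂ) →ₗ[ℝ] (ι → ℂ) := (Matrix.toLin' U.1).restrictScalars ℝ with hT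
  have hdet : LinearMap.det T = 1 := by
    rw [hT, LinearMap.det_restrictScalars, LinearMap.det_toLin', Algebra.norm_complex_apply,
      Complex.normSq_eq_norm_sq, hnorm, one_pow]
  have hdet_ne : LinearMap.det T ≠ 0 := hdet ▸ one_ne_zero
  have hmap := Measure.map_linearMap_addHaar_eq_smul_addHaar (volume : Measure (ι → ℂ)) hdet_ne
  rw [hdet, inv_one, abs_one, ENNReal.ofReal_one, one_smul] at hmap
  exact ⟨T.continuous_of_finiteDimensional.measurable, hmap⟩

theorem lintegral_exp_neg_weightedNormSq_one_add_mulVec (U : Matrix.unitaryGroup ι ℂ)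
    {a : ι → ℝ} (ha : ∀ i, 0 ≤ a i) :
    ∫⁻ g, ENNReal.ofReal (Real.exp (-(weightedNormSq 1 g + weightedNormSq a (U.1 *ᵥ g)))) =
      ENNReal.ofReal (∏ i, (Real.pi / (1 + a i))) := by
  have hmeas : Measurable fun g : ι → ℂ =>
      ENNReal.ofReal (Real.exp (-weightedNormSq (1 + a) g)) := by
    have := (continuous_weightedNormSq (1 + a)).measurable
    fun_prop
  calc ∫⁻ g, ENNReal.ofReal (Real.exp (-(weightedNormSq 1 g + weightedNormSq a (U.1 *ᵥ g))))
      = ∫⁻ g, ENNReal.ofReal (Real.exp (-weightedNormSq (1 + a) (U.1 *ᵥ g))) := by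
        simp only [weightedNormSq_add, weightedNormSq_one_mulVec]
    _ = ∫⁻ g, ENNReal.ofReal (Real.exp (-weightedNormSq (1 + a) g)) :=
        (measurePreserving_unitary_mulVec U).lintegral_comp hmeas
    _ = ENNReal.ofReal (∏ i, (Real.pi / (1 + a i))) :=
        lintegral_exp_neg_weightedNormSq fun i => add_pos_of_pos_of_nonneg one_pos (ha i)

end Gaussian

section HaarUnitary

variable {n : ℕ}

instance isProbabilityMeasure_haarUnitary (n : ℕ) : IsProbabilityMeasure (haarUnitary n) :=
  ⟨by simpa only [haarUnitary, TopologicalSpace.PositiveCompacts.coe_top] using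
    Measure.haarMeasure_self (G := Matrix.unitaryGroup (Fin n) ℂ) (K₀ := ⊤)⟩

instance isMulLeftInvariant_haarUnitary (n : ℕ) : (haarUnitary n).IsMulLeftInvariant :=
  inferInstanceAs (Measure.haarMeasure ⊤).IsMulLeftInvariant

instance isMulRightInvariant_haarUnitary (n : ℕ) : (haarUnitary n).IsMulRightInvariant := by
  refine ⟨fun g => ?_⟩
  have : IsProbabilityMeasure (Measure.map (· * g) (haarUnitary n)) :=
    Measure.isProbabilityMeasure_map (measurable_mul_const g).aemeasurable
  have hunique := Measure.haarMeasure_unique (Measure.map (· * g) (haarUnitary n)) ⊤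
  rwa [TopologicalSpace.PositiveCompacts.coe_top, measure_univ, one_smul] at hunique

theorem continuous_weightedNormSq_mulVec (a : Fin n → ℝ) :
    Continuous fun x : Matrix.unitaryGroup (Fin n) ℂ × (Fin n → ℂ) =>
      weightedNormSq a (x.1.1 *ᵥ x.2) :=
  (continuous_weightedNormSq a).comp <|
    (continuous_subtype_val.comp continuous_fst).matrix_mulVec continuous_snd

theorem lintegral_haarUnitary_weightedNormSq (F : ℝ → ENNReal) (a : Fin n → ℝ) (g : Fin n → ℂ)
    {v : Fin n → ℂ} (hv : v ≠ 0) :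
    ∫⁻ U, F (weightedNormSq a (U.1 *ᵥ g)) ∂(haarUnitary n) =
      ∫⁻ U, F (weightedNormSq 1 g * (weightedNormSq a (U.1 *ᵥ v) / weightedNormSq 1 v))
        ∂(haarUnitary n) := by
  obtain ⟨W, hW⟩ := exists_unitary_eq_smul_mulVec g hv
  rw [← lintegral_mul_right_eq_self (fun U => F (weightedNormSq 1 g * _)) W]
  refine lintegral_congr fun U => congrArg F ?_
  conv_lhs => rw [hW]
  rw [Matrix.mulVec_smul, Matrix.mulVec_mulVec, weightedNormSq_smul, div_pow,
    ← weightedNormSq_one_eq_norm_sq, ← weightedNormSq_one_eq_norm_sq, Submonoid.coe_mul]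
  ring

theorem lintegral_inv_pow_mul_pi_pow {α : Type*} [MeasurableSpace α] {μ : Measure α} [SFinite μ]
    {x : α → ℝ} (hx : Measurable x) (hxnonneg : ∀ u, 0 ≤ x u) :
    (∫⁻ u, ENNReal.ofReal ((1 + x u)⁻¹ ^ n) ∂μ) * ENNReal.ofReal (Real.pi ^ n) =
      ∫⁻ g : Fin n → ℂ, ∫⁻ u, ENNReal.ofReal
        (Real.exp (-(weightedNormSq 1 g + weightedNormSq 1 g * x u))) ∂μ := by
  have hone := (continuous_weightedNormSq (1 : Fin n → ℝ)).measurable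
  rw [← lintegral_lintegral_swap (Measurable.ennreal_ofReal (by fun_prop)).aemeasurable,
    ← lintegral_mul_const' _ _ ENNReal.ofReal_ne_top]
  refine lintegral_congr fun u => ?_
  have := hxnonneg u
  rw [← ENNReal.ofReal_mul (by positivity), ← mul_pow, ← div_eq_inv_mul]
  conv_rhs => simp only [← mul_one_add, mul_comm _ (1 + x u)]
  rw [lintegral_exp_neg_mul_weightedNormSq_one (by positivity), Fintype.card_fin]

/-- Both sides, times `π ^ n`, are the integral of `exp (-(|g|² + ∑ a_i |(U g)_i|²))` over `U` and
`g`: integrating over `g` first gives the right-hand side, and over `U` first, by invariance, the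
left-hand side. -/
theorem lintegral_haarUnitary_inv_pow {a : Fin n → ℝ} (ha : ∀ i, 0 ≤ a i) {v : Fin n → ℂ}
    (hv : v ≠ 0) :
    ∫⁻ U, ENNReal.ofReal ((1 + weightedNormSq a (U.1 *ᵥ v) / weightedNormSq 1 v)⁻¹ ^ n)
        ∂(haarUnitary n) = ENNReal.ofReal (∏ i, (1 + a i)⁻¹) := by
  set x : Matrix.unitaryGroup (Fin n) ℂ → ℝ := fun U =>
    weightedNormSq a (U.1 *ᵥ v) / weightedNormSq 1 v
  have hxnonneg : ∀ U, 0 ≤ x U := fun U => div_nonneg (weightedNormSq_nonneg ha _)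
    (weightedNormSq_nonneg (fun _ => zero_le_one) _)
  have hxcont : Continuous x :=
    ((continuous_weightedNormSq_mulVec a).comp (Continuous.prodMk_left v)).div_const _
  have hone := continuous_weightedNormSq (1 : Fin n → ℝ)
  have hmul := continuous_weightedNormSq_mulVec a
  have hpi : ENNReal.ofReal (Real.pi ^ n) ≠ 0 := (ENNReal.ofReal_pos.2 (by positivity)).ne'
  refine (ENNReal.mul_left_inj hpi ENNReal.ofReal_ne_top).1 ?_
  calc (∫⁻ U, ENNReal.ofReal ((1 + x U)⁻¹ ^ n) ∂(haarUnitary n)) * ENNReal.ofReal (Real.pi ^ n)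
      = ∫⁻ g : Fin n → ℂ, ∫⁻ U, ENNReal.ofReal
          (Real.exp (-(weightedNormSq 1 g + weightedNormSq 1 g * x U))) ∂(haarUnitary n) :=
        lintegral_inv_pow_mul_pi_pow hxcont.measurable hxnonneg
    _ = ∫⁻ g : Fin n → ℂ, ∫⁻ U, ENNReal.ofReal
          (Real.exp (-(weightedNormSq 1 g + weightedNormSq a (U.1 *ᵥ g)))) ∂(haarUnitary n) :=
        lintegral_congr fun g => (lintegral_haarUnitary_weightedNormSq
          (fun t => ENNReal.ofReal (Real.exp (-(weightedNormSq 1 g + t)))) a g hv).symm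
    _ = ∫⁻ U, (∫⁻ g : Fin n → ℂ, ENNReal.ofReal
          (Real.exp (-(weightedNormSq 1 g + weightedNormSq a (U.1 *ᵥ g))))) ∂(haarUnitary n) :=
        (lintegral_lintegral_swap
          (Continuous.measurable (by fun_prop)).ennreal_ofReal.aemeasurable).symm
    _ = ENNReal.ofReal (∏ i, (1 + a i)⁻¹) * ENNReal.ofReal (Real.pi ^ n) := by
        simp only [lintegral_exp_neg_weightedNormSq_one_add_mulVec _ ha, lintegral_const,
          measure_univ, mul_one, div_eq_inv_mul, Finset.prod_mul_distrib, Finset.prod_const,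
          Finset.card_univ, Fintype.card_fin]
        exact ENNReal.ofReal_mul (Finset.prod_nonneg fun i _ => by have := ha i; positivity)

end HaarUnitary

section HausdorffMoments

variable {ρ : Measure ℝ} [IsFiniteMeasure ρ] {C : ℝ}

theorem integrable_pow_of_ae_abs_le (h : ∀ᵐ x ∂ρ, |x| ≤ C) (k : ℕ) :
    Integrable (fun x => x ^ k) ρ := by
  refine (integrable_const (C ^ k)).mono' (by fun_prop) ?_
  filter_upwards [h] with x hx
  rw [norm_pow, Real.norm_eq_abs]
  exact pow_le_pow_left₀ (abs_nonneg x) hx k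

theorem integral_abs_pow_le_of_ae_abs_le (h : ∀ᵐ x ∂ρ, |x| ≤ C) (k : ℕ) :
    ∫ x, |x| ^ k ∂ρ ≤ C ^ k * ρ.real univ := by
  calc ∫ x, |x| ^ k ∂ρ ≤ ∫ _, C ^ k ∂ρ := by
        refine integral_mono_ae ?_ (integrable_const _) ?_
        · simpa only [norm_pow, Real.norm_eq_abs] using (integrable_pow_of_ae_abs_le h k).norm
        · filter_upwards [h] with x hx using pow_le_pow_left₀ (abs_nonneg x) hx k
    _ = C ^ k * ρ.real univ := by rw [integral_const, smul_eq_mul, mul_comm]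

theorem hasSum_charFun_of_ae_abs_le (h : ∀ᵐ x ∂ρ, |x| ≤ C) (t : ℝ) :
    HasSum (fun k : ℕ => ((t : ℂ) * Complex.I) ^ k / (k ! : ℂ) * ((∫ x, x ^ k ∂ρ : ℝ) : ℂ))
      (charFun ρ t) := by
  set F : ℕ → ℝ → ℂ := fun k x => ((t : ℂ) * Complex.I) ^ k / (k ! : ℂ) * ((x ^ k : ℝ) : ℂ)
    with hF
  have hFi : ∀ k, Integrable (F k) ρ := fun k =>
    (integrable_pow_of_ae_abs_le h k).ofReal.const_mul _
  have hnorm : ∀ k, ∫ x, ‖F k x‖ ∂ρ = |t| ^ k / (k ! : ℝ) * ∫ x, |x| ^ k ∂ρ := fun k => by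
    simp only [hF, norm_mul, norm_div, norm_pow, Complex.norm_I, mul_one, Complex.norm_real,
      Complex.norm_natCast, Real.norm_eq_abs, integral_const_mul]
  have hsum : Summable fun k => ∫ x, ‖F k x‖ ∂ρ := by
    refine Summable.of_nonneg_of_le (fun k => integral_nonneg fun x => norm_nonneg _)
      (fun k => ?_) ((Real.summable_pow_div_factorial (|t| * C)).mul_right (ρ.real univ))
    rw [hnorm, mul_pow, mul_div_right_comm, mul_assoc]
    exact mul_le_mul_of_nonneg_left (integral_abs_pow_le_of_ae_abs_le h k) (by positivity)
  have hexp : ∀ x : ℝ, ∑' k, F k x = Complex.exp (t * x * Complex.I) := fun x => by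
    rw [Complex.exp_eq_exp_ℂ, ← (NormedSpace.expSeries_div_hasSum_exp
      ((t : ℂ) * x * Complex.I)).tsum_eq]
    refine tsum_congr fun k => ?_
    simp only [hF, Complex.ofReal_pow, mul_pow]
    ring
  have hint : ∀ k, ∫ x, F k x ∂ρ =
      ((t : ℂ) * Complex.I) ^ k / (k ! : ℂ) * ((∫ x, x ^ k ∂ρ : ℝ) : ℂ) := fun k => by
    rw [← integral_complex_ofReal, ← integral_const_mul]
  simpa only [hexp, hint, charFun_apply_real] using
    hasSum_integral_of_summable_integral_norm hFi hsum

theorem ext_of_integral_pow_of_ae_abs_le {ρ' : Measure ℝ} [IsFiniteMeasure ρ']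
    (h : ∀ᵐ x ∂ρ, |x| ≤ C) (h' : ∀ᵐ x ∂ρ', |x| ≤ C)
    (heq : ∀ k : ℕ, ∫ x, x ^ k ∂ρ = ∫ x, x ^ k ∂ρ') : ρ = ρ' := by
  refine Measure.ext_of_charFun (funext fun t => ?_)
  have hsum := hasSum_charFun_of_ae_abs_le h t
  simp only [heq] at hsum
  exact hsum.unique (hasSum_charFun_of_ae_abs_le h' t)

end HausdorffMoments

section StieltjesDeterminacy

variable {ν ν' : Measure ℝ} [IsFiniteMeasure ν] [IsFiniteMeasure ν'] {j k n : ℕ} {z : ℝ}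

theorem ext_of_integral_inv_add_one_pow (hν : ∀ᵐ y ∂ν, 0 < y) (hν' : ∀ᵐ y ∂ν', 0 < y)
    (h : ∀ k : ℕ, ∫ y, ((y + 1)⁻¹) ^ k ∂ν = ∫ y, ((y + 1)⁻¹) ^ k ∂ν') : ν = ν' := by
  let e : ℝ ≃ᵐ ℝ := (MeasurableEquiv.addRight 1).trans (MeasurableEquiv.inv ℝ)
  have hle : ∀ {τ : Measure ℝ}, (∀ᵐ y ∂τ, 0 < y) → ∀ᵐ x ∂τ.map e, |x| ≤ 1 := fun hτ => by
    rw [ae_map_iff e.measurable.aemeasurable (measurableSet_le (by fun_prop) (by fun_prop))]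
    filter_upwards [hτ] with y hy
    change |(y + 1)⁻¹| ≤ 1
    rw [abs_of_pos (by positivity)]
    exact inv_le_one_of_one_le₀ (by linarith)
  refine e.map_measurableEquiv_injective
    (ext_of_integral_pow_of_ae_abs_le (hle hν) (hle hν') fun k => ?_)
  rw [integral_map_equiv, integral_map_equiv]
  exact h k

theorem pow_mul_inv_add_pow_le {y : ℝ} (hy : 0 ≤ y) (hz : 0 < z) (hjk : j ≤ k) :
    y ^ j * ((z + y) ^ k)⁻¹ ≤ (z ^ (k - j))⁻¹ := by
  obtain ⟨m, rfl⟩ := Nat.exists_eq_add_of_le hjk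
  rw [Nat.add_sub_cancel_left, pow_add, mul_inv, ← mul_assoc, ← div_eq_mul_inv]
  exact (mul_le_of_le_one_left (by positivity)
    (div_le_one_of_le₀ (pow_le_pow_left₀ hy (by linarith) j) (by positivity))).trans
    (inv_anti₀ (by positivity) (pow_le_pow_left₀ hz.le (by linarith) m))

theorem integrable_pow_mul_inv_add_pow (hν : ∀ᵐ y ∂ν, 0 < y) (hz : 0 < z) (hjk : j ≤ k) :
    Integrable (fun y => y ^ j * ((z + y) ^ k)⁻¹) ν := by
  refine (integrable_const ((z ^ (k - j))⁻¹)).mono' (Measurable.aestronglyMeasurable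
    (by fun_prop)) ?_
  filter_upwards [hν] with y hy
  rw [Real.norm_of_nonneg (by positivity)]
  exact pow_mul_inv_add_pow_le hy.le hz hjk

theorem hasDerivAt_integral_pow_mul_inv_add_pow (hν : ∀ᵐ y ∂ν, 0 < y) (hz : 0 < z)
    (hjk : j ≤ k + 1) :
    HasDerivAt (fun z => ∫ y, y ^ j * ((z + y) ^ (k + 1))⁻¹ ∂ν)
      (-(k + 1) * ∫ y, y ^ j * ((z + y) ^ (k + 2))⁻¹ ∂ν) z := by
  rw [← integral_const_mul]
  refine (hasDerivAt_integral_of_dominated_loc_of_deriv_le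
    (F' := fun z y => -(k + 1 : ℝ) * (y ^ j * ((z + y) ^ (k + 2))⁻¹))
    (bound := fun _ => (k + 1 : ℝ) * ((z / 2) ^ (k + 2 - j))⁻¹)
    (Ioi_mem_nhds (half_lt_self hz))
    (Filter.Eventually.of_forall fun w => Measurable.aestronglyMeasurable (by fun_prop))
    (integrable_pow_mul_inv_add_pow hν hz hjk)
    (Measurable.aestronglyMeasurable (by fun_prop)) ?_ (integrable_const _) ?_).2
  all_goals filter_upwards [hν] with y hy w (hw : z / 2 < w)
  all_goals have hw0 : 0 < w := by linarith
  · rw [norm_mul, norm_neg, Real.norm_of_nonneg (by positivity),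
      Real.norm_of_nonneg (by positivity)]
    refine mul_le_mul_of_nonneg_left ?_ (by positivity)
    refine (pow_mul_inv_add_pow_le hy.le hw0 (by lia)).trans ?_
    exact inv_anti₀ (by positivity) (pow_le_pow_left₀ (by positivity) hw.le _)
  · refine ((hasDerivAt_inv_add_pow (z := y) (by positivity : w + y ≠ 0) k).const_mul
      (y ^ j)).congr_deriv (by ring)

theorem integral_pow_mul_inv_add_pow_congr (hν : ∀ᵐ y ∂ν, 0 < y) (hν' : ∀ᵐ y ∂ν', 0 < y)
    (hn : 0 < n)
    (h : ∀ z, 0 < z → ∫ y, (y / (y + z)) ^ n ∂ν = ∫ y, (y / (y + z)) ^ n ∂ν') (m : ℕ) :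
    ∀ z, 0 < z →
      ∫ y, y ^ n * ((z + y) ^ (n + m))⁻¹ ∂ν = ∫ y, y ^ n * ((z + y) ^ (n + m))⁻¹ ∂ν' := by
  induction m with
  | zero => simpa only [div_pow, div_eq_mul_inv, mul_pow, inv_pow, add_zero, add_comm] using h
  | succ m ih =>
    intro z hz
    obtain ⟨k, hk⟩ : ∃ k, n + m = k + 1 := ⟨n + m - 1, by lia⟩
    rw [← add_assoc, hk]
    rw [hk] at ih
    have hder := hasDerivAt_integral_pow_mul_inv_add_pow hν hz (j := n) (k := k) (by lia)
    have hder' := hasDerivAt_integral_pow_mul_inv_add_pow hν' hz (j := n) (k := k) (by lia)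
    have hnear : (fun z => ∫ y, y ^ n * ((z + y) ^ (k + 1))⁻¹ ∂ν) =ᶠ[nhds z]
        fun z => ∫ y, y ^ n * ((z + y) ^ (k + 1))⁻¹ ∂ν' := by
      filter_upwards [Ioi_mem_nhds hz] with w hw using ih w hw
    exact mul_left_cancel₀ (by rw [neg_ne_zero]; positivity)
      (hder.unique (hder'.congr_of_eventuallyEq hnear))

theorem ext_of_withDensity_ofReal {α : Type*} [MeasurableSpace α] {μ μ' : Measure α} {f : α → ℝ}
    (hf : Measurable f) (hμ : ∀ᵐ x ∂μ, 0 < f x) (hμ' : ∀ᵐ x ∂μ', 0 < f x)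
    (h : μ.withDensity (fun x => ENNReal.ofReal (f x)) =
      μ'.withDensity fun x => ENNReal.ofReal (f x)) : μ = μ' := by
  have hinv : ∀ {τ : Measure α}, (∀ᵐ x ∂τ, 0 < f x) →
      (τ.withDensity fun x => ENNReal.ofReal (f x)).withDensity
        (fun x => (ENNReal.ofReal (f x))⁻¹) = τ := fun hτ =>
    withDensity_inv_same hf.ennreal_ofReal
      (hτ.mono fun x hx => (ENNReal.ofReal_pos.2 hx).ne')
      (Filter.Eventually.of_forall fun x => ENNReal.ofReal_ne_top)
  rw [← hinv hμ, ← hinv hμ', h]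

theorem integral_withDensity_ofReal {α : Type*} [MeasurableSpace α] {μ : Measure α} {f : α → ℝ}
    (hf : AEMeasurable f μ) (g : α → ℝ) :
    ∫ x, g x ∂μ.withDensity (fun x => ENNReal.ofReal (f x)) = ∫ x, max (f x) 0 * g x ∂μ := by
  rw [integral_withDensity_eq_integral_toReal_smul₀ hf.ennreal_ofReal
    (Filter.Eventually.of_forall fun _ => ENNReal.ofReal_lt_top)]
  simp only [ENNReal.toReal_ofReal', smul_eq_mul]

/-- Derivatives in `z` of the transform at `z = 1` are the moments of the image of
`(y / (y + 1)) ^ n ν` under `y ↦ (y + 1)⁻¹`, which is bounded. -/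
theorem ext_of_integral_div_add_pow (hν : ∀ᵐ y ∂ν, 0 < y) (hν' : ∀ᵐ y ∂ν', 0 < y) (hn : 0 < n)
    (h : ∀ z, 0 < z → ∫ y, (y / (y + z)) ^ n ∂ν = ∫ y, (y / (y + z)) ^ n ∂ν') : ν = ν' := by
  let w : ℝ → ℝ := fun y => y ^ n * ((1 + y) ^ n)⁻¹
  have hw : Measurable w := by fun_prop
  have hwpos : ∀ {τ : Measure ℝ}, (∀ᵐ y ∂τ, 0 < y) → ∀ᵐ y ∂τ, 0 < w y := fun hτ =>
    hτ.mono fun y hy => by positivity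
  have hfin : ∀ {τ : Measure ℝ} [IsFiniteMeasure τ], (∀ᵐ y ∂τ, 0 < y) →
      IsFiniteMeasure (τ.withDensity fun y => ENNReal.ofReal (w y)) := fun hτ =>
    isFiniteMeasure_withDensity_ofReal (integrable_pow_mul_inv_add_pow hτ one_pos le_rfl).2
  have hae : ∀ {τ : Measure ℝ}, (∀ᵐ y ∂τ, 0 < y) →
      ∀ᵐ y ∂τ.withDensity (fun y => ENNReal.ofReal (w y)), 0 < y := fun hτ =>
    (withDensity_absolutelyContinuous _ _).ae_le hτ
  have hmom : ∀ {τ : Measure ℝ}, (∀ᵐ y ∂τ, 0 < y) → ∀ k : ℕ,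
      ∫ y, ((y + 1)⁻¹) ^ k ∂τ.withDensity (fun y => ENNReal.ofReal (w y)) =
        ∫ y, y ^ n * ((1 + y) ^ (n + k))⁻¹ ∂τ := fun hτ k => by
    rw [integral_withDensity_ofReal hw.aemeasurable]
    refine integral_congr_ae ((hwpos hτ).mono fun y hy => ?_)
    simp only [max_eq_left hy.le, w, add_comm y 1, inv_pow, pow_add, mul_inv, mul_assoc]
  have := hfin hν
  have := hfin hν'
  refine ext_of_withDensity_ofReal hw (hwpos hν) (hwpos hν')
    (ext_of_integral_inv_add_one_pow (hae hν) (hae hν') fun k => ?_)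
  rw [hmom hν, hmom hν']
  exact integral_pow_mul_inv_add_pow_congr hν hν' hn h k 1 one_pos

end StieltjesDeterminacy

section DensityIdentification

theorem ae_nonneg_of_withDensity_neg_le {α : Type*} [MeasurableSpace α] {μ : Measure α}
    {f : α → ℝ} (hf : AEMeasurable f μ)
    (h : μ.withDensity (fun x => ENNReal.ofReal (-f x)) ≤
      μ.withDensity fun x => ENNReal.ofReal (f x)) : ∀ᵐ x ∂μ, 0 ≤ f x := by
  have hs : NullMeasurableSet {x | f x < 0} μ := nullMeasurableSet_lt hf aemeasurable_const
  have hzero : ∫⁻ x in {x | f x < 0}, ENNReal.ofReal (-f x) ∂μ = 0 := by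
    refine nonpos_iff_eq_zero.1 ?_
    rw [← withDensity_apply₀ _ hs]
    refine (h _).trans_eq ?_
    rw [withDensity_apply₀ _ hs, lintegral_eq_zero_iff' hf.ennreal_ofReal.restrict]
    filter_upwards [ae_restrict_mem₀ hs] with x hx using ENNReal.ofReal_of_nonpos hx.le
  rw [lintegral_eq_zero_iff' hf.fun_neg.ennreal_ofReal.restrict, Filter.EventuallyEq,
    ae_restrict_iff'₀ hs] at hzero
  filter_upwards [hzero] with x hx
  by_contra! hneg
  exact hneg.not_ge (neg_nonpos.1 (ENNReal.ofReal_eq_zero.1 (hx hneg)))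

theorem nonneg_of_ae_nonneg_of_continuousOn {X : Type*} [TopologicalSpace X] [MeasurableSpace X]
    {μ : Measure X} [μ.IsOpenPosMeasure] {f : X → ℝ} {U : Set X} (hU : IsOpen U)
    (hf : ContinuousOn f U) (h : ∀ᵐ x ∂μ.restrict U, 0 ≤ f x) : ∀ x ∈ U, 0 ≤ f x := fun x hx => by
  have heq : EqOn f (fun x => max (f x) 0) U := Measure.eqOn_open_of_ae_eq
    (h.mono fun x hx => (max_eq_left hx).symm) hU hf (hf.sup continuousOn_const)
  exact heq hx ▸ le_max_right _ _

variable {ν : Measure ℝ} [IsFiniteMeasure ν] {ρ : ℝ → ℝ} {n : ℕ}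

theorem add_withDensity_neg_eq_withDensity (hν : ∀ᵐ y ∂ν, 0 < y) (hi : IntegrableOn ρ (Ioi 0))
    (hn : 0 < n) (h : ∀ z, 0 < z → ∫ y, (y / (y + z)) ^ n ∂ν =
      ∫ y in Ioi (0 : ℝ), (y / (y + z)) ^ n * ρ y) :
    ν + (volume.restrict (Ioi 0)).withDensity (fun y => ENNReal.ofReal (-ρ y)) =
      (volume.restrict (Ioi 0)).withDensity fun y => ENNReal.ofReal (ρ y) := by
  have hfin := fun {f : ℝ → ℝ} (hf : IntegrableOn f (Ioi 0)) =>
    isFiniteMeasure_withDensity_ofReal hf.2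
  have := hfin hi
  have := hfin hi.neg
  have hpos : ∀ f : ℝ → ENNReal, ∀ᵐ y ∂(volume.restrict (Ioi 0)).withDensity f, 0 < y := fun f =>
    (withDensity_absolutelyContinuous _ _).ae_le (ae_restrict_mem measurableSet_Ioi)
  refine ext_of_integral_div_add_pow (ae_add_measure_iff.2 ⟨hν, hpos _⟩) (hpos _) hn fun z hz => ?_
  have hint : ∀ {τ : Measure ℝ} [IsFiniteMeasure τ], (∀ᵐ y ∂τ, 0 < y) →
      Integrable (fun y => (y / (y + z)) ^ n) τ := fun hτ => by
    simpa only [div_eq_mul_inv, mul_pow, inv_pow, add_comm] using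
      integrable_pow_mul_inv_add_pow hτ hz (le_refl n)
  rw [integral_add_measure (hint hν) (hint (hpos _)), h z hz,
    integral_withDensity_ofReal hi.aestronglyMeasurable.aemeasurable,
    integral_withDensity_ofReal hi.aestronglyMeasurable.aemeasurable.fun_neg,
    ← integral_add (integrableOn_div_add_pow_mul hi hz.le n)]
  · refine integral_congr_ae (Filter.Eventually.of_forall fun y => ?_)
    change (y / (y + z)) ^ n * ρ y + max (-ρ y) 0 * (y / (y + z)) ^ n = _
    rw [mul_comm, ← add_mul]
    congr 1
    rcases le_total (ρ y) 0 with h0 | h0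
    · rw [max_eq_left (by linarith), max_eq_right h0, add_neg_cancel]
    · rw [max_eq_right (by linarith), max_eq_left h0, add_zero]
  · simpa only [IntegrableOn, Pi.neg_apply, mul_comm] using
      integrableOn_div_add_pow_mul hi.neg.pos_part hz.le n

theorem eq_withDensity_of_integral_div_add_pow (hν : ∀ᵐ y ∂ν, 0 < y)
    (hc : ContinuousOn ρ (Ioi 0)) (hi : IntegrableOn ρ (Ioi 0)) (hn : 0 < n)
    (h : ∀ z, 0 < z → ∫ y, (y / (y + z)) ^ n ∂ν =
      ∫ y in Ioi (0 : ℝ), (y / (y + z)) ^ n * ρ y) :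
    (∀ y, 0 < y → 0 ≤ ρ y) ∧
      ν = (volume.restrict (Ioi 0)).withDensity fun y => ENNReal.ofReal (ρ y) := by
  have heq := add_withDensity_neg_eq_withDensity hν hi hn h
  have hae : ∀ᵐ y ∂volume.restrict (Ioi 0), 0 ≤ ρ y :=
    ae_nonneg_of_withDensity_neg_le hi.aestronglyMeasurable.aemeasurable
      (heq ▸ Measure.le_add_left le_rfl)
  refine ⟨nonneg_of_ae_nonneg_of_continuousOn isOpen_Ioi hc hae, ?_⟩
  have hzero : (fun y => ENNReal.ofReal (-ρ y)) =ᵐ[volume.restrict (Ioi 0)] 0 :=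
    hae.mono fun y hy => ENNReal.ofReal_of_nonpos (neg_nonpos.2 hy)
  rwa [withDensity_congr_ae hzero, withDensity_zero, add_zero] at heq

end DensityIdentification

section GramMatrix

variable {n : ℕ} {S : Matrix (Fin n) (Fin n) ℂ} {δ z : ℝ} {k : Fin n} {Λ : Fin n → ℝ}

theorem conjTranspose_sqrt (S : Matrix (Fin n) (Fin n) ℂ) : (CFC.sqrt S)ᴴ = CFC.sqrt S :=
  (CFC.sqrt_nonneg S).isSelfAdjoint

/-- The `k`-th column of `(√S)⁻¹`, whose squared Hermitian norm is `σ_k`. -/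
noncomputable def invSqrtCol (S : Matrix (Fin n) (Fin n) ℂ) (k : Fin n) : Fin n → ℂ :=
  fun j => (CFC.sqrt S)⁻¹ j k

theorem invDiag_eq_weightedNormSq (hS : S.PosSemidef) (k : Fin n) :
    invDiag S k = weightedNormSq 1 (invSqrtCol S k) := by
  have hinv : S⁻¹ = ((CFC.sqrt S)⁻¹)ᴴ * Matrix.diagonal (fun _ => ((1 : ℝ) : ℂ)) *
      (CFC.sqrt S)⁻¹ := by
    rw [Matrix.conjTranspose_nonsing_inv, conjTranspose_sqrt, Complex.ofReal_one,
      Matrix.diagonal_one, mul_one, ← Matrix.mul_inv_rev, CFC.sqrt_mul_sqrt_self S hS.nonneg]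
  rw [invDiag, hinv, conjTranspose_mul_diagonal_mul_apply_self (d := fun _ => 1),
    Complex.ofReal_re]
  rfl

theorem invDiag_pos (hS : S.PosDef) (k : Fin n) : 0 < invDiag S k :=
  (Complex.pos_iff.1 hS.inv.diag_pos).1

theorem invSqrtCol_ne_zero (hS : S.PosDef) (k : Fin n) : invSqrtCol S k ≠ 0 := fun h =>
  (invDiag_pos hS k).ne' <| by
    rw [invDiag_eq_weightedNormSq hS.posSemidef, weightedNormSq_one_eq_zero.2 h]

/-- The SINR `γ_k` of the channel `P √S` as a function of `A = P† P`. -/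
noncomputable def gramSINR (δ : ℝ) (S : Matrix (Fin n) (Fin n) ℂ) (k : Fin n)
    (A : Matrix (Fin n) (Fin n) ℂ) : ℝ :=
  δ / (((CFC.sqrt S)ᴴ * A * CFC.sqrt S)⁻¹ k k).re

theorem zfSINR_channel {nr : ℕ} (δ : ℝ) (P : Matrix (Fin nr) (Fin n) ℂ)
    (S : Matrix (Fin n) (Fin n) ℂ) (k : Fin n) :
    zfSINR δ (channel P S) k = gramSINR δ S k (Pᴴ * P) := by
  simp only [zfSINR, channel, gramSINR, Matrix.conjTranspose_mul, Matrix.mul_assoc]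

theorem measurable_gramSINR (δ : ℝ) (S : Matrix (Fin n) (Fin n) ℂ) (k : Fin n) :
    Measurable (gramSINR δ S k) := by
  have hcont : Continuous fun A : Matrix (Fin n) (Fin n) ℂ => (CFC.sqrt S)ᴴ * A * CFC.sqrt S := by
    fun_prop
  have hdet := hcont.matrix_det.measurable
  have hadj := (hcont.matrix_adjugate.matrix_elem k k).measurable
  unfold gramSINR
  simp only [Matrix.inv_def, Ring.inverse_eq_inv', Matrix.smul_apply, smul_eq_mul]
  exact measurable_const.div (Complex.measurable_re.comp (hdet.inv.mul hadj))

/-- The map `(U, Λ) ↦ U† Λ U`, under which `invariantLaw` is the image of a product measure. -/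
noncomputable def conjDiagonal (x : Matrix.unitaryGroup (Fin n) ℂ × (Fin n → ℝ)) :
    Matrix (Fin n) (Fin n) ℂ :=
  x.1.1ᴴ * Matrix.diagonal (fun i => (x.2 i : ℂ)) * x.1.1

theorem measurable_conjDiagonal : Measurable (conjDiagonal (n := n)) := by
  have hU : Continuous fun x : Matrix.unitaryGroup (Fin n) ℂ × (Fin n → ℝ) => x.1.1 :=
    continuous_subtype_val.comp continuous_fst
  have hΛ : Continuous fun x : Matrix.unitaryGroup (Fin n) ℂ × (Fin n → ℝ) =>
      Matrix.diagonal (fun i => (x.2 i : ℂ)) :=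
    Continuous.matrix_diagonal (by fun_prop)
  exact ((hU.matrix_conjTranspose.matrix_mul hΛ).matrix_mul hU).measurable

theorem inv_diagonal_ofReal {ι : Type*} [Fintype ι] [DecidableEq ι] {d : ι → ℝ}
    (hd : ∀ i, d i ≠ 0) :
    (Matrix.diagonal fun i => (d i : ℂ))⁻¹ = Matrix.diagonal fun i => ((d⁻¹ i : ℝ) : ℂ) := by
  refine Matrix.inv_eq_left_inv ?_
  rw [Matrix.diagonal_mul_diagonal, ← Matrix.diagonal_one]
  congr 1
  ext i
  rw [← Complex.ofReal_mul, Pi.inv_apply, inv_mul_cancel₀ (hd i), Complex.ofReal_one]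

theorem gramSINR_conjDiagonal (δ : ℝ) (S : Matrix (Fin n) (Fin n) ℂ) (k : Fin n)
    (U : Matrix.unitaryGroup (Fin n) ℂ) (hΛ : ∀ i, Λ i ≠ 0) :
    gramSINR δ S k (conjDiagonal (U, Λ)) =
      δ / weightedNormSq Λ⁻¹ (U.1 *ᵥ invSqrtCol S k) := by
  set T := CFC.sqrt S
  have hU : U.1⁻¹ = U.1ᴴ := Matrix.inv_eq_left_inv (Matrix.mem_unitaryGroup_iff'.1 U.2)
  have hU' : U.1ᴴ⁻¹ = U.1 := Matrix.inv_eq_left_inv (Matrix.mem_unitaryGroup_iff.1 U.2)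
  have hinv : (Tᴴ * conjDiagonal (U, Λ) * T)⁻¹ =
      (U.1 * T⁻¹)ᴴ * Matrix.diagonal (fun i => ((Λ⁻¹ i : ℝ) : ℂ)) * (U.1 * T⁻¹) := by
    simp only [conjDiagonal, Matrix.mul_inv_rev, hU, hU', inv_diagonal_ofReal hΛ,
      Matrix.conjTranspose_mul, Matrix.conjTranspose_nonsing_inv, T, conjTranspose_sqrt,
      Matrix.mul_assoc]
  rw [gramSINR, hinv, conjTranspose_mul_diagonal_mul_apply_self, Complex.ofReal_re]
  rfl

theorem gramSINR_conjDiagonal_pos (hS : S.PosDef) (hδ : 0 < δ) (k : Fin n)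
    (U : Matrix.unitaryGroup (Fin n) ℂ) (hΛ : ∀ i, 0 < Λ i) :
    0 < gramSINR δ S k (conjDiagonal (U, Λ)) := by
  rw [gramSINR_conjDiagonal δ S k U fun i => (hΛ i).ne']
  exact div_pos hδ (weightedNormSq_pos (fun i => inv_pos.2 (hΛ i))
    (unitary_mulVec_ne_zero U (invSqrtCol_ne_zero hS k)))

theorem lintegral_haarUnitary_gramSINR (hS : S.PosDef) (hδ : 0 < δ) (k : Fin n)
    (hΛ : ∀ i, 0 < Λ i) (hz : 0 < z) :
    ∫⁻ U, ENNReal.ofReal ((gramSINR δ S k (conjDiagonal (U, Λ)) /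
        (gramSINR δ S k (conjDiagonal (U, Λ)) + z)) ^ n) ∂(haarUnitary n) =
      ENNReal.ofReal (∏ i, (Λ i / (Λ i + invDiag S k / δ * z))) := by
  have hσ := invDiag_pos hS k
  have hv := invSqrtCol_ne_zero hS k
  have hprod : ∏ i, (Λ i / (Λ i + invDiag S k / δ * z)) =
      ∏ i, (1 + invDiag S k / δ * z * Λ⁻¹ i)⁻¹ :=
    Finset.prod_congr rfl fun i _ => by
      have := hΛ i
      rw [Pi.inv_apply]
      field_simp
  rw [hprod, ← lintegral_haarUnitary_inv_pow (a := fun i => invDiag S k / δ * z * Λ⁻¹ i)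
    (fun i => mul_nonneg (by positivity) (inv_nonneg.2 (hΛ i).le)) hv]
  refine lintegral_congr fun U => ?_
  have hX := weightedNormSq_pos (a := Λ⁻¹) (fun i => inv_pos.2 (hΛ i))
    (unitary_mulVec_ne_zero U hv)
  rw [weightedNormSq_const_mul, ← invDiag_eq_weightedNormSq hS.posSemidef,
    gramSINR_conjDiagonal δ S k U fun i => (hΛ i).ne']
  congr 2
  field_simp

end GramMatrix

section SINRLaw

variable {n : ℕ} {p : ℕ → Polynomial ℝ} {q : ℕ → ℝ → ℝ} {S : Matrix (Fin n) (Fin n) ℂ} {δ z : ℝ}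

theorem invariantLaw_eq_map (n : ℕ) (q : ℕ → ℝ → ℝ) :
    invariantLaw n q = ((haarUnitary n).prod ((orthantVolume n).withDensity fun Λ =>
      ENNReal.ofReal (eigenDensity n q Λ))).map conjDiagonal := rfl

instance sigmaFinite_orthantVolume (n : ℕ) : SigmaFinite (orthantVolume n) := by
  unfold orthantVolume; infer_instance

theorem ae_gramSINR_pos (q : ℕ → ℝ → ℝ) (hS : S.PosDef) (hδ : 0 < δ) (k : Fin n) :
    ∀ᵐ A ∂(invariantLaw n q), 0 < gramSINR δ S k A := by
  rw [invariantLaw_eq_map, ae_map_iff measurable_conjDiagonal.aemeasurable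
    (measurableSet_lt measurable_const (measurable_gramSINR δ S k))]
  have h : ∀ᵐ Λ ∂((orthantVolume n).withDensity fun Λ =>
      ENNReal.ofReal (eigenDensity n q Λ)), ∀ i, 0 < Λ i :=
    (withDensity_absolutelyContinuous _ _).ae_le (ae_orthantVolume_pos n)
  filter_upwards [Measure.quasiMeasurePreserving_snd.ae h] with x hx
  exact gramSINR_conjDiagonal_pos hS hδ k x.1 hx

theorem lintegral_invariantLaw (hq : Integrable (eigenDensity n q) (orthantVolume n))
    {g : Matrix (Fin n) (Fin n) ℂ → ENNReal} (hg : Measurable g) :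
    ∫⁻ A, g A ∂(invariantLaw n q) =
      ∫⁻ Λ, ENNReal.ofReal (eigenDensity n q Λ) *
        ∫⁻ U, g (conjDiagonal (U, Λ)) ∂(haarUnitary n) ∂(orthantVolume n) := by
  have hcomp : Measurable fun x : Matrix.unitaryGroup (Fin n) ℂ × (Fin n → ℝ) =>
      g (conjDiagonal x) := hg.comp measurable_conjDiagonal
  rw [invariantLaw_eq_map, lintegral_map hg measurable_conjDiagonal,
    lintegral_prod_symm _ hcomp.aemeasurable,
    lintegral_withDensity_eq_lintegral_mul₀ hq.aestronglyMeasurable.aemeasurable.ennreal_ofReal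
      hcomp.lintegral_prod_left'.aemeasurable]
  rfl

theorem ae_prod_div_add_mem_Icc (n : ℕ) (hz : 0 ≤ z) :
    ∀ᵐ Λ ∂(orthantVolume n), ∏ a, (Λ a / (Λ a + z)) ∈ Icc (0 : ℝ) 1 := by
  filter_upwards [ae_orthantVolume_pos n] with Λ hΛ
  have h : ∀ a, Λ a / (Λ a + z) ∈ Icc (0 : ℝ) 1 := fun a =>
    have := hΛ a
    ⟨by positivity, div_le_one_of_le₀ (by linarith) (by linarith)⟩
  exact ⟨Finset.prod_nonneg fun a _ => (h a).1,
    Finset.prod_le_one (fun a _ => (h a).1) fun a _ => (h a).2⟩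

theorem IsBiorthonormal.integral_invariantLaw_gramSINR (h : IsBiorthonormal n p q) (hn : 0 < n)
    (hq : ∀ᵐ Λ ∂(orthantVolume n), 0 ≤ eigenDensity n q Λ) (hS : S.PosDef) (hδ : 0 < δ)
    (k : Fin n) (hz : 0 < z) :
    ∫ A, (gramSINR δ S k A / (gramSINR δ S k A + z)) ^ n ∂(invariantLaw n q) =
      ∫ y in Ioi (0 : ℝ), y / (y + invDiag S k / δ * z) * kernel n p q 0 y := by
  have hσ := invDiag_pos hS k
  set c := invDiag S k / δ * z
  have hc0 : 0 ≤ c := by positivity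
  have hm : Measurable fun A : Matrix (Fin n) (Fin n) ℂ =>
      (gramSINR δ S k A / (gramSINR δ S k A + z)) ^ n := by
    have := measurable_gramSINR δ S k
    fun_prop
  have hbound := ae_prod_div_add_mem_Icc n hc0
  have hnonneg : 0 ≤ᵐ[orthantVolume n] fun Λ => eigenDensity n q Λ * ∏ a, (Λ a / (Λ a + c)) := by
    filter_upwards [hq, hbound] with Λ h0 h1 using mul_nonneg h0 h1.1
  have hint : Integrable (fun Λ => eigenDensity n q Λ * ∏ a, (Λ a / (Λ a + c)))
      (orthantVolume n) := by
    refine h.integrable_eigenDensity.mul_bdd (c := 1)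
      (Measurable.aestronglyMeasurable (by fun_prop)) ?_
    filter_upwards [hbound] with Λ h1
    rw [Real.norm_of_nonneg h1.1]
    exact h1.2
  rw [← h.integral_eigenDensity_mul_prod hn hc0, integral_eq_lintegral_of_nonneg_ae _
    hm.aestronglyMeasurable, integral_eq_lintegral_of_nonneg_ae hnonneg hint.aestronglyMeasurable,
    lintegral_invariantLaw h.integrable_eigenDensity hm.ennreal_ofReal]
  · congr 1
    refine lintegral_congr_ae ?_
    filter_upwards [ae_orthantVolume_pos n, hq] with Λ hΛ h0
    rw [lintegral_haarUnitary_gramSINR hS hδ k hΛ hz, ENNReal.ofReal_mul h0]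
  · filter_upwards [ae_gramSINR_pos q hS hδ k] with A hA
    exact pow_nonneg (div_nonneg hA.le (by linarith)) n

section Ensemble

variable {Ω : Type*} [MeasurableSpace Ω] {μ : Measure Ω} {nr : ℕ}
  {P : Ω → Matrix (Fin nr) (Fin n) ℂ}

theorem aemeasurable_gram (hP : AEMeasurable P μ) : AEMeasurable (fun w => (P w)ᴴ * P w) μ := by
  have hcont : Continuous fun A : Matrix (Fin nr) (Fin n) ℂ => Aᴴ * A := by fun_prop
  exact hcont.measurable.comp_aemeasurable hP

theorem aemeasurable_zfSINR_channel (hP : AEMeasurable P μ) (δ : ℝ)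
    (S : Matrix (Fin n) (Fin n) ℂ) (k : Fin n) :
    AEMeasurable (fun w => zfSINR δ (channel (P w) S) k) μ := by
  simp only [zfSINR_channel]
  exact (measurable_gramSINR δ S k).comp_aemeasurable (aemeasurable_gram hP)

theorem IsInvariantPolynomialEnsemble.map_zfSINR_channel
    (hP : IsInvariantPolynomialEnsemble μ P q) (δ : ℝ) (S : Matrix (Fin n) (Fin n) ℂ)
    (k : Fin n) :
    μ.map (fun w => zfSINR δ (channel (P w) S) k) =
      (invariantLaw n q).map (gramSINR δ S k) := by
  rw [← hP.map_gram, AEMeasurable.map_map_of_aemeasurable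
    (measurable_gramSINR δ S k).aemeasurable (aemeasurable_gram hP.aemeasurable)]
  simp only [zfSINR_channel, Function.comp_def]

end Ensemble

end SINRLaw

section PolyaSINRLaw

variable {n : ℕ} {ω : ℝ → ℝ} {σ δ : ℝ}

theorem integral_div_add_pow_comp_mul (ω : ℝ → ℝ) (n : ℕ) {b z : ℝ} (hb : 0 < b) :
    ∫ y in Ioi (0 : ℝ), (y / (y + b * z)) ^ n * ω y =
      ∫ y in Ioi (0 : ℝ), (y / (y + z)) ^ n * (b * ω (b * y)) := by
  have h := integral_comp_mul_left_Ioi (fun y => (y / (y + b * z)) ^ n * ω y) 0 hb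
  rw [mul_zero, smul_eq_mul, inv_mul_eq_div, eq_div_iff hb.ne', mul_comm,
    ← integral_const_mul] at h
  rw [← h]
  refine integral_congr_ae (Filter.Eventually.of_forall fun y => ?_)
  dsimp only
  rw [← mul_add, mul_div_mul_left _ _ hb.ne']
  ring

/-- The density of the SINR of a stream with `(Σ_t⁻¹)_{kk} = σ`. -/
noncomputable def sinrDensity (ω : ℝ → ℝ) (σ δ γ : ℝ) : ℝ :=
  σ / (δ * mellinAt ω 1) * ω (σ * γ / δ)

theorem sinrDensity_eq (ω : ℝ → ℝ) (σ δ γ : ℝ) :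
    sinrDensity ω σ δ γ = 1 / mellinAt ω 1 * (σ / δ * ω (σ / δ * γ)) := by
  rw [sinrDensity, mul_div_right_comm σ γ δ]
  ring

theorem integrableOn_sinrDensity (hω : IntegrableOn ω (Ioi 0)) (hσ : 0 < σ) (hδ : 0 < δ) :
    IntegrableOn (sinrDensity ω σ δ) (Ioi 0) := by
  have h := (integrableOn_Ioi_comp_mul_left_iff ω 0 (div_pos hσ hδ)).2 (by rwa [mul_zero])
  exact ((h.const_mul (σ / δ)).const_mul (1 / mellinAt ω 1)).congr
    (Filter.Eventually.of_forall fun y => (sinrDensity_eq ω σ δ y).symm)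

theorem continuousOn_sinrDensity (hω : ContinuousOn ω (Ioi 0)) (hσ : 0 < σ) (hδ : 0 < δ) :
    ContinuousOn (sinrDensity ω σ δ) (Ioi 0) :=
  continuousOn_const.mul <| hω.comp (by fun_prop) fun _ hy => div_pos (mul_pos hσ hy) hδ

variable {S : Matrix (Fin n) (Fin n) ℂ} {Ω : Type*} [MeasurableSpace Ω] {μ : Measure Ω} {nr : ℕ}
  {P : Ω → Matrix (Fin nr) (Fin n) ℂ}

theorem IsPolyaEnsemble.integral_map_zfSINR (hP : IsPolyaEnsemble μ P ω) (hn : 0 < n)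
    (hS : S.PosDef) (hδ : 0 < δ) (k : Fin n) {z : ℝ} (hz : 0 < z) :
    ∫ y, (y / (y + z)) ^ n ∂(μ.map fun w => zfSINR δ (channel (P w) S) k) =
      ∫ y in Ioi (0 : ℝ), (y / (y + z)) ^ n * sinrDensity ω (invDiag S k) δ y := by
  have hc : 0 < invDiag S k / δ := div_pos (invDiag_pos hS k) hδ
  rw [hP.ensemble.map_zfSINR_channel, integral_map (measurable_gramSINR δ S k).aemeasurable
      (Measurable.aestronglyMeasurable (by fun_prop)),
    hP.weight.isBiorthonormal.integral_invariantLaw_gramSINR hn hP.ensemble.density_nonneg hS hδ k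
      hz]
  refine (hP.weight.integral_div_add_mul_polyaKernel hn (by positivity)).trans ?_
  rw [integral_div_add_pow_comp_mul ω n hc, ← integral_const_mul]
  refine integral_congr_ae (Filter.Eventually.of_forall fun y => ?_)
  simp only [sinrDensity_eq]
  ring

theorem IsPolyaEnsemble.sinr_law [IsProbabilityMeasure μ] (hP : IsPolyaEnsemble μ P ω)
    (hn : 0 < n) (hS : S.PosDef) (hδ : 0 < δ) (k : Fin n) :
    (∀ γ, 0 < γ → 0 ≤ sinrDensity ω (invDiag S k) δ γ) ∧
      μ.map (fun w => zfSINR δ (channel (P w) S) k) = (volume.restrict (Ioi 0)).withDensity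
        fun γ => ENNReal.ofReal (sinrDensity ω (invDiag S k) δ γ) := by
  have hσ := invDiag_pos hS k
  have : IsProbabilityMeasure (μ.map fun w => zfSINR δ (channel (P w) S) k) :=
    Measure.isProbabilityMeasure_map (aemeasurable_zfSINR_channel hP.ensemble.aemeasurable δ S k)
  have hpos : ∀ᵐ y ∂(μ.map fun w => zfSINR δ (channel (P w) S) k), 0 < y := by
    rw [hP.ensemble.map_zfSINR_channel,
      ae_map_iff (measurable_gramSINR δ S k).aemeasurable measurableSet_Ioi]
    exact ae_gramSINR_pos _ hS hδ k
  exact eq_withDensity_of_integral_div_add_pow hpos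
    (continuousOn_sinrDensity hP.weight.contDiffOn.continuousOn hσ hδ)
    (integrableOn_sinrDensity (hP.weight.integrableOn_weight hn) hσ hδ) hn
    fun z hz => hP.integral_map_zfSINR hn hS hδ k hz

end PolyaSINRLaw

section Mellin

variable {s : ℂ} {x r : ℝ}

theorem continuousOn_inv_one_add : ContinuousOn (fun x : ℝ => (1 + x)⁻¹) (Ioi 0) :=
  ContinuousOn.inv₀ (by fun_prop) fun x hx => by
    rw [mem_Ioi] at hx
    positivity

theorem mellinConvergent_inv_one_add (h0 : 0 < s.re) (h1 : s.re < 1) :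
    MellinConvergent (fun x : ℝ => (((1 + x)⁻¹ : ℝ) : ℂ)) s := by
  refine mellinConvergent_of_isBigO_rpow (a := 1) (b := 0)
    ((Complex.continuous_ofReal.comp_continuousOn
      continuousOn_inv_one_add).locallyIntegrableOn measurableSet_Ioi) ?_ h1 ?_ h0
  · refine Asymptotics.IsBigO.of_bound 1 ?_
    filter_upwards [Filter.eventually_gt_atTop 0] with x hx
    rw [Complex.norm_real, Real.rpow_neg_one, one_mul, Real.norm_of_nonneg (by positivity),
      Real.norm_of_nonneg (by positivity)]
    exact inv_anti₀ hx (by linarith)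
  · refine Asymptotics.IsBigO.of_bound 1 ?_
    filter_upwards [self_mem_nhdsWithin] with x hx
    have hx : (0 : ℝ) < x := hx
    rw [Complex.norm_real, neg_zero, Real.rpow_zero, Real.norm_of_nonneg (by positivity), norm_one,
      mul_one]
    exact inv_le_one_of_one_le₀ (by linarith)

/-- The integrand of the double integral over `(0, ∞)²` that equals the Mellin transform of
`(1 + x)⁻¹` when `t` is integrated first, and `Γ(s) Γ(1 - s)` when `x` is. -/
noncomputable def mellinLaplaceKernel (s : ℂ) (x t : ℝ) : ℂ :=
  (x : ℂ) ^ (s - 1) * ((Real.exp (-(t * x)) * Real.exp (-t) : ℝ) : ℂ)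

theorem measurable_mellinLaplaceKernel (s : ℂ) :
    Measurable (Function.uncurry (mellinLaplaceKernel s)) :=
  ((Complex.measurable_ofReal.comp measurable_fst).pow_const _).mul (by fun_prop)

theorem norm_mellinLaplaceKernel (s : ℂ) (hx : 0 < x) (t : ℝ) :
    ‖mellinLaplaceKernel s x t‖ = x ^ (s.re - 1) * Real.exp (-(t * x)) * Real.exp (-t) := by
  rw [mellinLaplaceKernel, norm_mul, Complex.norm_cpow_eq_rpow_re_of_pos hx, Complex.norm_real,
    Real.norm_of_nonneg (by positivity), Complex.sub_re, Complex.one_re, mul_assoc]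

theorem integral_exp_neg_mul_mul_exp_neg (hx : 0 < x) :
    ∫ t in Ioi (0 : ℝ), Real.exp (-(t * x)) * Real.exp (-t) = (1 + x)⁻¹ := by
  have h := integral_exp_mul_Ioi (a := -(1 + x)) (by linarith) 0
  rw [mul_zero, Real.exp_zero, neg_div_neg_eq, one_div] at h
  rw [← h]
  refine integral_congr_ae (Filter.Eventually.of_forall fun t => ?_)
  simp only [← Real.exp_add]
  congr 1
  ring

theorem integral_mellinLaplaceKernel_right (s : ℂ) (hx : 0 < x) :
    ∫ t in Ioi (0 : ℝ), mellinLaplaceKernel s x t =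
      (x : ℂ) ^ (s - 1) • (((1 + x)⁻¹ : ℝ) : ℂ) := by
  simp only [mellinLaplaceKernel]
  rw [integral_const_mul, integral_complex_ofReal, integral_exp_neg_mul_mul_exp_neg hx, smul_eq_mul]

theorem integral_mellinLaplaceKernel_left (h0 : 0 < s.re) {t : ℝ} (ht : 0 < t) :
    ∫ x in Ioi (0 : ℝ), mellinLaplaceKernel s x t =
      Complex.Gamma s * ((Real.exp (-t) : ℂ) * (t : ℂ) ^ (1 - s - 1)) := by
  have hfactor : ∀ x : ℝ, mellinLaplaceKernel s x t =
      (x : ℂ) ^ (s - 1) * Complex.exp (-((t : ℂ) * x)) * (Real.exp (-t) : ℂ) := fun x => by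
    rw [mellinLaplaceKernel]
    push_cast
    ring
  have harg : (t : ℂ).arg ≠ Real.pi := by
    rw [Complex.arg_ofReal_of_nonneg ht.le]
    exact Real.pi_pos.ne
  simp only [hfactor]
  rw [integral_mul_const, Complex.integral_cpow_mul_exp_neg_mul_Ioi h0 ht, one_div,
    Complex.inv_cpow _ _ harg, ← Complex.cpow_neg, sub_sub_cancel_left]
  ring

theorem integral_norm_mellinLaplaceKernel_left (h0 : 0 < s.re) {t : ℝ} (ht : 0 < t) :
    ∫ x in Ioi (0 : ℝ), ‖mellinLaplaceKernel s x t‖ =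
      Real.Gamma s.re * (Real.exp (-t) * t ^ (1 - s.re - 1)) := by
  rw [setIntegral_congr_fun measurableSet_Ioi fun x hx => norm_mellinLaplaceKernel s hx t,
    integral_mul_const, Real.integral_rpow_mul_exp_neg_mul_Ioi h0 ht, one_div,
    Real.inv_rpow ht.le, ← Real.rpow_neg ht.le, sub_sub_cancel_left]
  ring

theorem integrableOn_mellinLaplaceKernel_left (h0 : 0 < s.re) {t : ℝ} (ht : 0 < t) :
    IntegrableOn (fun x => mellinLaplaceKernel s x t) (Ioi 0) := by
  have h := integrableOn_rpow_mul_exp_neg_mul_rpow (s := s.re - 1) (p := 1) (b := t)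
    (by linarith) one_pos ht
  simp only [Real.rpow_one, neg_mul] at h
  refine (Integrable.mul_const h (Real.exp (-t))).mono'
    ((measurable_mellinLaplaceKernel s).comp measurable_prodMk_right).aestronglyMeasurable ?_
  filter_upwards [ae_restrict_mem measurableSet_Ioi] with x hx
  exact (norm_mellinLaplaceKernel s hx t).le

theorem integrable_mellinLaplaceKernel (h0 : 0 < s.re) (h1 : s.re < 1) :
    Integrable (Function.uncurry (mellinLaplaceKernel s))
      ((volume.restrict (Ioi 0)).prod (volume.restrict (Ioi 0))) := by
  rw [integrable_prod_iff' (measurable_mellinLaplaceKernel s).aestronglyMeasurable]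
  refine ⟨?_, ?_⟩
  · filter_upwards [ae_restrict_mem measurableSet_Ioi] with t ht
    exact integrableOn_mellinLaplaceKernel_left h0 ht
  · refine ((Real.GammaIntegral_convergent (s := 1 - s.re) (by linarith)).const_mul
      (Real.Gamma s.re)).congr ?_
    filter_upwards [ae_restrict_mem measurableSet_Ioi] with t ht
    exact (integral_norm_mellinLaplaceKernel_left h0 ht).symm

theorem mellin_inv_one_add (h0 : 0 < s.re) (h1 : s.re < 1) :
    mellin (fun x : ℝ => (((1 + x)⁻¹ : ℝ) : ℂ)) s = Complex.Gamma s * Complex.Gamma (1 - s) := by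
  have hΓ : 0 < (1 - s).re := by rwa [Complex.sub_re, Complex.one_re, sub_pos]
  calc mellin (fun x : ℝ => (((1 + x)⁻¹ : ℝ) : ℂ)) s
      = ∫ x in Ioi (0 : ℝ), ∫ t in Ioi (0 : ℝ), mellinLaplaceKernel s x t :=
        setIntegral_congr_fun measurableSet_Ioi fun x hx =>
          (integral_mellinLaplaceKernel_right s hx).symm
    _ = ∫ t in Ioi (0 : ℝ), ∫ x in Ioi (0 : ℝ), mellinLaplaceKernel s x t :=
        integral_integral_swap (integrable_mellinLaplaceKernel h0 h1)
    _ = ∫ t in Ioi (0 : ℝ), Complex.Gamma s * ((Real.exp (-t) : ℂ) * (t : ℂ) ^ (1 - s - 1)) :=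
        setIntegral_congr_fun measurableSet_Ioi fun t ht => integral_mellinLaplaceKernel_left h0 ht
    _ = Complex.Gamma s * Complex.Gamma (1 - s) := by
        rw [integral_const_mul, Complex.Gamma_eq_integral hΓ, Complex.GammaIntegral]

theorem log_one_add_inv_nonneg (hx : 0 < x) : 0 ≤ Real.log (1 + x⁻¹) :=
  Real.log_nonneg (by have := inv_pos.2 hx; linarith)

theorem log_one_add_inv_le_inv (hx : 0 < x) : Real.log (1 + x⁻¹) ≤ x⁻¹ := by
  have := Real.log_le_sub_one_of_pos (by positivity : 0 < 1 + x⁻¹)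
  linarith

theorem log_one_add_inv_le_rpow {ε : ℝ} (hx : 0 < x) (hx1 : x ≤ 1) (hε : 0 < ε) :
    Real.log (1 + x⁻¹) ≤ 2 ^ ε / ε * x ^ (-ε) := by
  have h1 : (1 : ℝ) + x⁻¹ ≤ 2 * x⁻¹ := by
    have := (one_le_inv₀ hx).2 hx1
    linarith
  calc Real.log (1 + x⁻¹) ≤ (1 + x⁻¹) ^ ε / ε := Real.log_le_rpow_div (by positivity) hε
    _ ≤ (2 * x⁻¹) ^ ε / ε := by gcongr
    _ = 2 ^ ε / ε * x ^ (-ε) := by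
      rw [Real.mul_rpow (by norm_num) (by positivity), Real.inv_rpow hx.le, Real.rpow_neg hx.le]
      ring

theorem hasDerivAt_log_one_add_inv (hx : 0 < x) :
    HasDerivAt (fun x : ℝ => Real.log (1 + x⁻¹)) (-(x⁻¹ * (1 + x)⁻¹)) x := by
  refine (((hasDerivAt_inv hx.ne').const_add 1).log (by positivity)).congr_deriv ?_
  field_simp
  ring

theorem continuousOn_log_one_add_inv :
    ContinuousOn (fun x : ℝ => Real.log (1 + x⁻¹)) (Ioi 0) := fun _ hx =>
  (hasDerivAt_log_one_add_inv hx).continuousAt.continuousWithinAt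

theorem mellinConvergent_log_one_add_inv (h0 : 0 < s.re) (h1 : s.re < 1) :
    MellinConvergent (fun x : ℝ => ((Real.log (1 + x⁻¹) : ℝ) : ℂ)) s := by
  refine mellinConvergent_of_isBigO_rpow (a := 1) (b := s.re / 2)
    ((Complex.continuous_ofReal.comp_continuousOn
      continuousOn_log_one_add_inv).locallyIntegrableOn measurableSet_Ioi) ?_ h1 ?_ (by linarith)
  · refine Asymptotics.IsBigO.of_bound 1 ?_
    filter_upwards [Filter.eventually_gt_atTop 0] with x hx
    rw [Complex.norm_real, Real.rpow_neg_one, one_mul,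
      Real.norm_of_nonneg (log_one_add_inv_nonneg hx), Real.norm_of_nonneg (by positivity)]
    exact log_one_add_inv_le_inv hx
  · refine Asymptotics.IsBigO.of_bound (2 ^ (s.re / 2) / (s.re / 2)) ?_
    filter_upwards [Ioc_mem_nhdsGT (zero_lt_one' ℝ)] with x hx
    rw [Complex.norm_real, Real.norm_of_nonneg (log_one_add_inv_nonneg hx.1),
      Real.norm_of_nonneg (Real.rpow_nonneg hx.1.le _)]
    exact log_one_add_inv_le_rpow hx.1 hx.2 (by linarith)

theorem tendsto_log_one_add_inv_mul_rpow_nhdsGT_zero {a : ℝ} (ha : 0 < a) :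
    Filter.Tendsto (fun x : ℝ => Real.log (1 + x⁻¹) * x ^ a) (nhdsWithin 0 (Ioi 0)) (nhds 0) := by
  have hlim : Filter.Tendsto (fun x : ℝ => 2 ^ (a / 2) / (a / 2) * x ^ (a / 2))
      (nhdsWithin 0 (Ioi 0)) (nhds 0) := by
    have h := ((Real.continuousAt_rpow_const 0 (a / 2) (Or.inr (by linarith))).const_mul
      (2 ^ (a / 2) / (a / 2))).tendsto.mono_left (nhdsWithin_le_nhds (s := Ioi 0))
    rwa [Real.zero_rpow (by linarith), mul_zero] at h
  refine squeeze_zero' ?_ ?_ hlim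
  · filter_upwards [self_mem_nhdsWithin] with x hx
    exact mul_nonneg (log_one_add_inv_nonneg hx) (Real.rpow_nonneg (le_of_lt hx) _)
  · filter_upwards [Ioc_mem_nhdsGT (zero_lt_one' ℝ)] with x hx
    calc Real.log (1 + x⁻¹) * x ^ a
        ≤ 2 ^ (a / 2) / (a / 2) * x ^ (-(a / 2)) * x ^ a :=
          mul_le_mul_of_nonneg_right (log_one_add_inv_le_rpow hx.1 hx.2 (by linarith))
            (Real.rpow_nonneg hx.1.le _)
      _ = 2 ^ (a / 2) / (a / 2) * x ^ (a / 2) := by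
          rw [mul_assoc, ← Real.rpow_add hx.1]
          congr 2
          ring

theorem tendsto_log_one_add_inv_mul_rpow_atTop {a : ℝ} (ha : a < 1) :
    Filter.Tendsto (fun x : ℝ => Real.log (1 + x⁻¹) * x ^ a) Filter.atTop (nhds 0) := by
  refine squeeze_zero' ?_ ?_ (tendsto_rpow_neg_atTop (by linarith : 0 < 1 - a))
  · filter_upwards [Filter.eventually_gt_atTop 0] with x hx
    exact mul_nonneg (log_one_add_inv_nonneg hx) (Real.rpow_nonneg hx.le _)
  · filter_upwards [Filter.eventually_gt_atTop 0] with x hx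
    calc Real.log (1 + x⁻¹) * x ^ a ≤ x⁻¹ * x ^ a :=
          mul_le_mul_of_nonneg_right (log_one_add_inv_le_inv hx) (Real.rpow_nonneg hx.le _)
      _ = x ^ (-(1 - a)) := by
          rw [← Real.rpow_neg_one, ← Real.rpow_add hx, neg_sub, neg_add_eq_sub]

theorem norm_log_one_add_inv_mul_cpow_div (s : ℂ) (hx : 0 < x) :
    ‖((Real.log (1 + x⁻¹) : ℝ) : ℂ) * ((x : ℂ) ^ s / s)‖ =
      Real.log (1 + x⁻¹) * x ^ s.re / ‖s‖ := by
  rw [norm_mul, norm_div, Complex.norm_real, Complex.norm_cpow_eq_rpow_re_of_pos hx,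
    Real.norm_of_nonneg (log_one_add_inv_nonneg hx), mul_div_assoc]

theorem tendsto_log_one_add_inv_mul_cpow_div (s : ℂ) {l : Filter ℝ} (hl : ∀ᶠ x in l, 0 < x)
    (h : Filter.Tendsto (fun x : ℝ => Real.log (1 + x⁻¹) * x ^ s.re) l (nhds 0)) :
    Filter.Tendsto (fun x : ℝ => ((Real.log (1 + x⁻¹) : ℝ) : ℂ) * ((x : ℂ) ^ s / s)) l
      (nhds 0) := by
  have hdiv := h.div_const ‖s‖
  rw [zero_div] at hdiv
  refine squeeze_zero_norm' ?_ hdiv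
  filter_upwards [hl] with x hx
  exact (norm_log_one_add_inv_mul_cpow_div s hx).le

theorem mellin_log_one_add_inv (h0 : 0 < s.re) (h1 : s.re < 1) :
    mellin (fun x : ℝ => ((Real.log (1 + x⁻¹) : ℝ) : ℂ)) s =
      Complex.Gamma s * Complex.Gamma (1 - s) / s := by
  have hs : s ≠ 0 := by
    rintro rfl
    exact h0.ne' Complex.zero_re
  let u : ℝ → ℂ := fun x => ((Real.log (1 + x⁻¹) : ℝ) : ℂ)
  let u' : ℝ → ℂ := fun x => ((-(x⁻¹ * (1 + x)⁻¹) : ℝ) : ℂ)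
  let v : ℝ → ℂ := fun x => (x : ℂ) ^ s / s
  let v' : ℝ → ℂ := fun x => (x : ℂ) ^ (s - 1)
  have hu : ∀ x ∈ Ioi (0 : ℝ), HasDerivAt u (u' x) x := fun x hx =>
    (hasDerivAt_log_one_add_inv hx).ofReal_comp
  have hv : ∀ x ∈ Ioi (0 : ℝ), HasDerivAt v (v' x) x := fun x hx =>
    ((hasDerivAt_ofReal_cpow_const (ne_of_gt hx) hs).div_const s).congr_deriv
      (mul_div_cancel_left₀ _ hs)
  have hu'v : ∀ x ∈ Ioi (0 : ℝ), u' x * v x =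
      -(1 / s) * ((x : ℂ) ^ (s - 1) • (((1 + x)⁻¹ : ℝ) : ℂ)) := fun x hx => by
    have hx' : (x : ℂ) ≠ 0 := Complex.ofReal_ne_zero.2 (ne_of_gt hx)
    simp only [u', v, smul_eq_mul]
    rw [Complex.cpow_sub _ _ hx', Complex.cpow_one]
    push_cast
    field_simp
  have huv'_int : IntegrableOn (u * v') (Ioi 0) :=
    (mellinConvergent_log_one_add_inv h0 h1).congr
      (Filter.Eventually.of_forall fun x => mul_comm (v' x) (u x))
  have hu'v_int : IntegrableOn (u' * v) (Ioi 0) :=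
    IntegrableOn.congr_fun ((mellinConvergent_inv_one_add h0 h1).const_mul (-(1 / s)))
      (fun x hx => (hu'v x hx).symm) measurableSet_Ioi
  have hparts := integral_Ioi_mul_deriv_eq_deriv_mul hu hv huv'_int hu'v_int
    (tendsto_log_one_add_inv_mul_cpow_div s self_mem_nhdsWithin
      (tendsto_log_one_add_inv_mul_rpow_nhdsGT_zero h0))
    (tendsto_log_one_add_inv_mul_cpow_div s (Filter.eventually_gt_atTop 0)
      (tendsto_log_one_add_inv_mul_rpow_atTop h1))
  rw [setIntegral_congr_fun measurableSet_Ioi hu'v, integral_const_mul] at hparts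
  have hmellin : mellin u s = ∫ x in Ioi (0 : ℝ), u x * v' x :=
    setIntegral_congr_fun measurableSet_Ioi fun x _ => mul_comm (v' x) (u x)
  rw [hmellin, hparts, ← mellin, mellin_inv_one_add h0 h1]
  ring

theorem normSq_sin_add_mul_I (a b : ℝ) :
    Complex.normSq (Complex.sin (a + b * Complex.I)) = Real.sin a ^ 2 + Real.sinh b ^ 2 := by
  rw [Complex.sin_add_mul_I, ← Complex.ofReal_sin, ← Complex.ofReal_cos, ← Complex.ofReal_sinh,
    ← Complex.ofReal_cosh, ← Complex.ofReal_mul, ← Complex.ofReal_mul, Complex.normSq_add_mul_I,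
    mul_pow, mul_pow, Real.cosh_sq]
  linear_combination Real.sinh b ^ 2 * Real.sin_sq_add_cos_sq a

theorem sq_le_sinh_sq (b : ℝ) : b ^ 2 ≤ Real.sinh b ^ 2 := by
  rw [sq_le_sq, Real.abs_sinh]
  exact Real.self_le_sinh_iff.2 (abs_nonneg b)

theorem sin_sq_mul_le_norm_sin_sq (r t : ℝ) :
    Real.sin (Real.pi * r) ^ 2 * (1 + t ^ 2) ≤
      ‖Complex.sin ((Real.pi : ℂ) * ((r : ℂ) + t * Complex.I))‖ ^ 2 := by
  have harg : (Real.pi : ℂ) * ((r : ℂ) + t * Complex.I) =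
      ((Real.pi * r : ℝ) : ℂ) + ((Real.pi * t : ℝ) : ℂ) * Complex.I := by
    push_cast
    ring
  have hpi : t ^ 2 ≤ (Real.pi * t) ^ 2 := by
    rw [mul_pow]
    exact le_mul_of_one_le_left (sq_nonneg t) (one_le_pow₀ (by linarith [Real.pi_gt_three]))
  rw [harg, ← Complex.normSq_eq_norm_sq, normSq_sin_add_mul_I]
  calc Real.sin (Real.pi * r) ^ 2 * (1 + t ^ 2)
      = Real.sin (Real.pi * r) ^ 2 + Real.sin (Real.pi * r) ^ 2 * t ^ 2 := by ring
    _ ≤ Real.sin (Real.pi * r) ^ 2 + 1 * t ^ 2 := by gcongr; exact Real.sin_sq_le_one _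
    _ ≤ Real.sin (Real.pi * r) ^ 2 + Real.sinh (Real.pi * t) ^ 2 := by
        rw [one_mul]
        exact add_le_add_right (hpi.trans (sq_le_sinh_sq _)) _

theorem sq_mul_le_norm_add_mul_I_sq (h0 : 0 ≤ r) (h1 : r ≤ 1) (t : ℝ) :
    r ^ 2 * (1 + t ^ 2) ≤ ‖(r : ℂ) + t * Complex.I‖ ^ 2 := by
  rw [← Complex.normSq_eq_norm_sq, Complex.normSq_add_mul_I]
  nlinarith [mul_nonneg (sq_nonneg t) (sub_nonneg.2 (pow_le_one₀ h0 h1 : r ^ 2 ≤ 1))]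

theorem mul_sin_mul_le_norm_sin_mul_norm (h0 : 0 ≤ r) (h1 : r ≤ 1) (t : ℝ) :
    r * Real.sin (Real.pi * r) * (1 + t ^ 2) ≤
      ‖Complex.sin ((Real.pi : ℂ) * ((r : ℂ) + t * Complex.I))‖ * ‖(r : ℂ) + t * Complex.I‖ := by
  refine le_of_sq_le_sq ?_ (by positivity)
  calc (r * Real.sin (Real.pi * r) * (1 + t ^ 2)) ^ 2
      = Real.sin (Real.pi * r) ^ 2 * (1 + t ^ 2) * (r ^ 2 * (1 + t ^ 2)) := by ring
    _ ≤ ‖Complex.sin ((Real.pi : ℂ) * ((r : ℂ) + t * Complex.I))‖ ^ 2 *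
          ‖(r : ℂ) + t * Complex.I‖ ^ 2 :=
        mul_le_mul (sin_sq_mul_le_norm_sin_sq r t) (sq_mul_le_norm_add_mul_I_sq h0 h1 t)
          (by positivity) (by positivity)
    _ = _ := by ring

theorem mellin_log_one_add_inv_vertical (h0 : 0 < r) (h1 : r < 1) (t : ℝ) :
    mellin (fun x : ℝ => ((Real.log (1 + x⁻¹) : ℝ) : ℂ)) ((r : ℂ) + t * Complex.I) =
      (Real.pi : ℂ) / (Complex.sin ((Real.pi : ℂ) * ((r : ℂ) + t * Complex.I)) *
        ((r : ℂ) + t * Complex.I)) := by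
  rw [mellin_log_one_add_inv (by simpa using h0) (by simpa using h1),
    Complex.Gamma_mul_Gamma_one_sub, div_div]

theorem verticalIntegrable_mellin_log_one_add_inv (h0 : 0 < r) (h1 : r < 1) :
    Complex.VerticalIntegrable (mellin fun x : ℝ => ((Real.log (1 + x⁻¹) : ℝ) : ℂ)) r := by
  have hsin : 0 < Real.sin (Real.pi * r) :=
    Real.sin_pos_of_pos_of_lt_pi (by positivity) (mul_lt_of_lt_one_right Real.pi_pos h1)
  have hbound := mul_sin_mul_le_norm_sin_mul_norm h0.le h1.le
  have hne : ∀ t : ℝ, Complex.sin ((Real.pi : ℂ) * ((r : ℂ) + t * Complex.I)) *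
      ((r : ℂ) + t * Complex.I) ≠ 0 := fun t => by
    rw [← norm_pos_iff, norm_mul]
    exact lt_of_lt_of_le (by positivity) (hbound t)
  simp only [Complex.VerticalIntegrable, mellin_log_one_add_inv_vertical h0 h1]
  refine (integrable_inv_one_add_sq.const_mul (Real.pi / (r * Real.sin (Real.pi * r)))).mono'
    (Continuous.aestronglyMeasurable (continuous_const.div (by fun_prop) hne))
    (Filter.Eventually.of_forall fun t => ?_)
  rw [norm_div, norm_mul, Complex.norm_real, Real.norm_of_nonneg Real.pi_pos.le,
    ← div_eq_mul_inv, div_div]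
  exact div_le_div_of_nonneg_left Real.pi_pos.le (by positivity) (hbound t)

theorem meijerIntegrand_eq (hx : 0 < x) (h0 : 0 < s.re) (h1 : s.re < 1) :
    meijerIntegrand [1, 1] [] [1] [0] x s = ((x⁻¹ : ℝ) : ℂ) ^ (-s) •
      mellin (fun x : ℝ => ((Real.log (1 + x⁻¹) : ℝ) : ℂ)) s := by
  have hs : s ≠ 0 := by
    rintro rfl
    exact h0.ne' Complex.zero_re
  have hΓ : Complex.Gamma s ≠ 0 := Complex.Gamma_ne_zero_of_re_pos h0
  have harg : (x : ℂ).arg ≠ Real.pi := by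
    rw [Complex.arg_ofReal_of_nonneg hx.le]
    exact Real.pi_pos.ne
  rw [mellin_log_one_add_inv h0 h1, Complex.ofReal_inv, Complex.inv_cpow _ _ harg,
    Complex.cpow_neg, inv_inv, smul_eq_mul]
  simp only [meijerIntegrand, List.map_cons, List.map_nil, List.prod_cons, List.prod_nil, mul_one,
    sub_self, zero_add, sub_zero, one_mul]
  rw [add_comm 1 s, Complex.Gamma_add_one s hs]
  field_simp

theorem meijerG_eq_log (hx : 0 < x) (hr : Separates r [1, 1] [1]) :
    meijerG r [1, 1] [] [1] [0] x = ((Real.log (1 + x) : ℝ) : ℂ) := by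
  have h0 : 0 < r := by simpa using hr.1 1 (by simp)
  have h1 : r < 1 := by simpa using hr.2 1 (by simp)
  have hx' : 0 < x⁻¹ := inv_pos.2 hx
  have hinversion := mellinInv_mellin_eq r (fun x : ℝ => ((Real.log (1 + x⁻¹) : ℝ) : ℂ)) hx'
    (mellinConvergent_log_one_add_inv (by simpa using h0) (by simpa using h1))
    (verticalIntegrable_mellin_log_one_add_inv h0 h1)
    (Complex.continuous_ofReal.continuousAt.comp
      (continuousOn_log_one_add_inv.continuousAt (Ioi_mem_nhds hx')))
  have hline : ∀ t : ℝ, meijerIntegrand [1, 1] [] [1] [0] x (r + t * Complex.I) =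
      ((x⁻¹ : ℝ) : ℂ) ^ (-(r + t * Complex.I)) •
        mellin (fun x : ℝ => ((Real.log (1 + x⁻¹) : ℝ) : ℂ)) (r + t * Complex.I) := fun t =>
    meijerIntegrand_eq hx (by simpa using h0) (by simpa using h1)
  rw [inv_inv] at hinversion
  rw [← hinversion, mellinInv, meijerG]
  simp only [hline]
  rw [Complex.real_smul]
  push_cast
  rfl

end Mellin

section SumRate

variable {n : ℕ} {ω : ℝ → ℝ} {c r : ℝ}

theorem IsPolyaWeight.integrableOn_id_mul (h : IsPolyaWeight n ω) (hn : 1 < n) :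
    IntegrableOn (fun x => x * ω x) (Ioi 0) := by
  have hint := h.integrableOn 1 hn 0 (by omega)
  simp only [pow_one, iteratedDeriv_zero, pow_zero, one_mul] at hint
  exact hint

theorem log_one_add_le_self {x : ℝ} (hx : 0 ≤ x) : Real.log (1 + x) ≤ x := by
  linarith [Real.log_le_sub_one_of_pos (by linarith : 0 < 1 + x)]

theorem IsPolyaWeight.integrableOn_mul_log (h : IsPolyaWeight n ω) (hn : 1 < n) (hc : 0 ≤ c) :
    IntegrableOn (fun x => ω x * Real.log (1 + c * x)) (Ioi 0) := by
  refine ((h.integrableOn_id_mul hn).norm.const_mul c).mono' ?_ ?_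
  · exact (h.integrableOn_weight (by omega)).aestronglyMeasurable.mul
      (Measurable.aestronglyMeasurable (by fun_prop))
  · filter_upwards [ae_restrict_mem measurableSet_Ioi] with x hx
    have hx : 0 < x := hx
    have hcx : 0 ≤ c * x := by positivity
    rw [norm_mul, norm_mul, Real.norm_of_nonneg (Real.log_nonneg (by linarith)),
      Real.norm_of_nonneg hx.le]
    calc ‖ω x‖ * Real.log (1 + c * x) ≤ ‖ω x‖ * (c * x) :=
          mul_le_mul_of_nonneg_left (log_one_add_le_self hcx) (norm_nonneg _)
      _ = c * (x * ‖ω x‖) := by ring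

theorem IsPolyaWeight.integrableOn_mul_meijerG (h : IsPolyaWeight n ω) (hn : 1 < n)
    (hc : 0 < c) (hr : Separates r [1, 1] [1]) :
    IntegrableOn (fun x : ℝ => (ω x : ℂ) * meijerG r [1, 1] [] [1] [0] (c * x)) (Ioi 0) := by
  refine (Integrable.ofReal (𝕜 := ℂ) (h.integrableOn_mul_log hn hc.le)).congr ?_
  filter_upwards [ae_restrict_mem measurableSet_Ioi] with x hx
  rw [meijerG_eq_log (mul_pos hc hx) hr]
  exact Complex.ofReal_mul _ _

theorem ofReal_integral_mul_log (ω : ℝ → ℝ) (hc : 0 < c) (hr : Separates r [1, 1] [1]) :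
    ((∫ x in Ioi (0 : ℝ), ω x * Real.log (1 + c * x) : ℝ) : ℂ) =
      ∫ x in Ioi (0 : ℝ), (ω x : ℂ) * meijerG r [1, 1] [] [1] [0] (c * x) := by
  rw [← integral_complex_ofReal]
  refine setIntegral_congr_fun measurableSet_Ioi fun x hx => ?_
  rw [meijerG_eq_log (mul_pos hc hx) hr, Complex.ofReal_mul]

theorem invDiag_one (k : Fin n) : invDiag (1 : Matrix (Fin n) (Fin n) ℂ) k = 1 := by
  rw [invDiag, inv_one, Matrix.one_apply_eq, Complex.one_re]

section WithDensity

variable {α Ω : Type*} [MeasurableSpace α] [MeasurableSpace Ω] {μ : Measure Ω} {X : Ω → α}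
  {ν : Measure α} {ρ g : α → ℝ}

theorem integrable_comp_of_map_eq_withDensity (hX : AEMeasurable X μ) (hρm : AEMeasurable ρ ν)
    (hρ : 0 ≤ᵐ[ν] ρ) (hg : Measurable g)
    (hlaw : μ.map X = ν.withDensity fun x => ENNReal.ofReal (ρ x))
    (hint : Integrable (fun x => ρ x * g x) ν) : Integrable (fun w => g (X w)) μ := by
  refine (integrable_map_measure hg.aestronglyMeasurable hX).1 ?_
  rw [hlaw, integrable_withDensity_iff_integrable_smul₀' hρm.ennreal_ofReal
    (Filter.Eventually.of_forall fun _ => ENNReal.ofReal_lt_top)]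
  refine hint.congr ?_
  filter_upwards [hρ] with x hx
  rw [ENNReal.toReal_ofReal hx, smul_eq_mul]

theorem integral_comp_of_map_eq_withDensity (hX : AEMeasurable X μ) (hρm : AEMeasurable ρ ν)
    (hρ : 0 ≤ᵐ[ν] ρ) (hg : Measurable g)
    (hlaw : μ.map X = ν.withDensity fun x => ENNReal.ofReal (ρ x)) :
    ∫ w, g (X w) ∂μ = ∫ x, ρ x * g x ∂ν := by
  rw [← integral_map hX hg.aestronglyMeasurable, hlaw, integral_withDensity_ofReal hρm]
  refine integral_congr_ae ?_
  filter_upwards [hρ] with x hx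
  rw [max_eq_left (show 0 ≤ ρ x from hx)]

end WithDensity

section ChangeOfVariables

variable {σ δ : ℝ}

theorem sinrDensity_mul_log (ω : ℝ → ℝ) (hσ : σ ≠ 0) (hδ : δ ≠ 0) (γ : ℝ) :
    sinrDensity ω σ δ γ * Real.log (1 + γ) = 1 / mellinAt ω 1 *
      (σ / δ * (ω (σ / δ * γ) * Real.log (1 + δ / σ * (σ / δ * γ)))) := by
  have hinv : δ / σ * (σ / δ * γ) = γ := by field_simp
  rw [hinv, sinrDensity_eq]
  ring

theorem IsPolyaWeight.integrableOn_sinrDensity_mul_log (h : IsPolyaWeight n ω) (hn : 1 < n)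
    (hσ : 0 < σ) (hδ : 0 < δ) :
    IntegrableOn (fun γ => sinrDensity ω σ δ γ * Real.log (1 + γ)) (Ioi 0) := by
  have hF := (integrableOn_Ioi_comp_mul_left_iff
    (fun x => ω x * Real.log (1 + δ / σ * x)) 0 (div_pos hσ hδ)).2
    (by rw [mul_zero]; exact h.integrableOn_mul_log hn (div_pos hδ hσ).le)
  simp only [sinrDensity_mul_log ω hσ.ne' hδ.ne']
  exact (hF.const_mul (σ / δ)).const_mul (1 / mellinAt ω 1)

theorem integral_sinrDensity_mul_log (ω : ℝ → ℝ) (hσ : 0 < σ) (hδ : 0 < δ) :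
    ∫ γ in Ioi (0 : ℝ), sinrDensity ω σ δ γ * Real.log (1 + γ) =
      1 / mellinAt ω 1 * ∫ x in Ioi (0 : ℝ), ω x * Real.log (1 + δ / σ * x) := by
  have hc : 0 < σ / δ := div_pos hσ hδ
  simp only [sinrDensity_mul_log ω hσ.ne' hδ.ne']
  rw [integral_const_mul, integral_const_mul, integral_comp_mul_left_Ioi
    (fun x => ω x * Real.log (1 + δ / σ * x)) 0 hc, mul_zero, smul_eq_mul,
    mul_inv_cancel_left₀ hc.ne']

end ChangeOfVariables

variable {Ω : Type*} [MeasurableSpace Ω] {μ : Measure Ω} [IsProbabilityMeasure μ] {nr : ℕ}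
  {P : Ω → Matrix (Fin nr) (Fin n) ℂ} {S : Matrix (Fin n) (Fin n) ℂ} {δ : ℝ}

theorem IsPolyaEnsemble.integrable_log_one_add_zfSINR (hP : IsPolyaEnsemble μ P ω)
    (hn : 1 < n) (hS : S.PosDef) (hδ : 0 < δ) (k : Fin n) :
    Integrable (fun w => Real.log (1 + zfSINR δ (channel (P w) S) k)) μ := by
  have hn0 : 0 < n := by omega
  obtain ⟨hpos, hlaw⟩ := hP.sinr_law hn0 hS hδ k
  exact integrable_comp_of_map_eq_withDensity (g := fun x => Real.log (1 + x))
    (aemeasurable_zfSINR_channel hP.ensemble.aemeasurable δ S k)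
    (integrableOn_sinrDensity (hP.weight.integrableOn_weight hn0) (invDiag_pos hS k)
      hδ).aestronglyMeasurable.aemeasurable
    (ae_restrict_of_forall_mem measurableSet_Ioi hpos) (by fun_prop) hlaw
    (hP.weight.integrableOn_sinrDensity_mul_log hn (invDiag_pos hS k) hδ)

theorem IsPolyaEnsemble.integral_log_one_add_zfSINR (hP : IsPolyaEnsemble μ P ω)
    (hn : 0 < n) (hS : S.PosDef) (hδ : 0 < δ) (k : Fin n) :
    ∫ w, Real.log (1 + zfSINR δ (channel (P w) S) k) ∂μ =
      1 / mellinAt ω 1 * ∫ x in Ioi (0 : ℝ), ω x * Real.log (1 + δ / invDiag S k * x) := by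
  obtain ⟨hpos, hlaw⟩ := hP.sinr_law hn hS hδ k
  rw [← integral_sinrDensity_mul_log ω (invDiag_pos hS k) hδ]
  exact integral_comp_of_map_eq_withDensity (g := fun x => Real.log (1 + x))
    (aemeasurable_zfSINR_channel hP.ensemble.aemeasurable δ S k)
    (integrableOn_sinrDensity (hP.weight.integrableOn_weight hn) (invDiag_pos hS k)
      hδ).aestronglyMeasurable.aemeasurable
    (ae_restrict_of_forall_mem measurableSet_Ioi hpos) (by fun_prop) hlaw

theorem IsPolyaWeight.integrableOn_mul_sum_meijerG (h : IsPolyaWeight n ω) (hn : 1 < n)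
    (hS : S.PosDef) (hδ : 0 < δ) (hr : Separates r [1, 1] [1]) :
    IntegrableOn (fun x : ℝ => (ω x : ℂ) *
      ∑ k : Fin n, meijerG r [1, 1] [] [1] [0] (δ * x / invDiag S k)) (Ioi 0) := by
  simp only [Finset.mul_sum, mul_div_right_comm δ]
  exact integrable_finsetSum _ fun k _ =>
    h.integrableOn_mul_meijerG hn (div_pos hδ (invDiag_pos hS k)) hr

theorem IsPolyaEnsemble.zfSumRate_eq (hP : IsPolyaEnsemble μ P ω) (hn : 1 < n) (hS : S.PosDef)
    (hδ : 0 < δ) (hr : Separates r [1, 1] [1]) :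
    (zfSumRate μ δ (fun w => channel (P w) S) : ℂ) =
      1 / (mellinAt ω 1 : ℂ) * ∫ x in Ioi (0 : ℝ), (ω x : ℂ) *
        ∑ k : Fin n, meijerG r [1, 1] [] [1] [0] (δ * x / invDiag S k) := by
  have hc : ∀ k, 0 < δ / invDiag S k := fun k => div_pos hδ (invDiag_pos hS k)
  simp only [Finset.mul_sum, mul_div_right_comm δ]
  rw [integral_finsetSum _ fun k _ => hP.weight.integrableOn_mul_meijerG hn (hc k) hr,
    Finset.mul_sum, zfSumRate, Complex.ofReal_sum]
  refine Finset.sum_congr rfl fun k _ => ?_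
  rw [hP.integral_log_one_add_zfSINR (by omega) hS hδ k, ← ofReal_integral_mul_log ω (hc k) hr]
  push_cast
  rfl

theorem IsPolyaEnsemble.zfSumRate_one_eq (hP : IsPolyaEnsemble μ P ω) (hn : 1 < n)
    (hδ : 0 < δ) (hr : Separates r [1, 1] [1]) :
    (zfSumRate μ δ (fun w => channel (P w) 1) : ℂ) =
      (n : ℂ) * (1 / (mellinAt ω 1 : ℂ) * ∫ x in Ioi (0 : ℝ),
        (ω x : ℂ) * meijerG r [1, 1] [] [1] [0] (δ * x)) := by
  rw [hP.zfSumRate_eq hn Matrix.PosDef.one hδ hr]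
  simp only [invDiag_one, div_one, Finset.sum_const, Finset.card_univ, Fintype.card_fin,
    nsmul_eq_mul, mul_left_comm _ (n : ℂ)]
  rw [integral_const_mul]
  ring

end SumRate

end ZFMimo

theorem mainTheorem3 {Ω : Type*} [MeasurableSpace Ω] (μ : Measure Ω) [IsProbabilityMeasure μ]
    (nr nt : ℕ) (hnt : 2 ≤ nt) (hnr : nt ≤ nr)
    (ω : ℝ → ℝ) (P : Ω → Matrix (Fin nr) (Fin nt) ℂ) (hP : IsPolyaEnsemble μ P ω)
    (S : Matrix (Fin nt) (Fin nt) ℂ) (hS : S.PosDef) (δ : ℝ) (hδ : 0 < δ) :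
    -- the explicit polynomials are the biorthonormal ones, so `polyaKernel` is the kernel
    IsBiorthonormal nt (polyaP ω) (polyaQ ω) ∧
    -- the kernel at `x = 0`, wherever `ω` is `n_t - 1` times differentiable, hence a.e.
    (∀ᵐ y : ℝ, 0 < y → DifferentiableAt ℝ (iteratedDeriv (nt - 2) ω) y) ∧
    (∀ y : ℝ, 0 < y → DifferentiableAt ℝ (iteratedDeriv (nt - 2) ω) y →
      polyaKernel nt ω 0 y =
        1 / (((nt - 1).factorial : ℝ) * mellinAt ω 1) * (1 / y) *
          iteratedDeriv (nt - 1) (fun x => x ^ nt * ω x) y) ∧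
    -- the density of the SINR of each stream
    (∀ k : Fin nt,
      (∀ γ : ℝ, 0 < γ →
        0 ≤ invDiag S k / (δ * mellinAt ω 1) * ω (invDiag S k * γ / δ)) ∧
      μ.map (fun w => zfSINR δ (channel (P w) S) k) =
        (volume.restrict (Ioi 0)).withDensity fun γ =>
          ENNReal.ofReal (invDiag S k / (δ * mellinAt ω 1) * ω (invDiag S k * γ / δ))) ∧
    -- the sum rate
    (∀ k : Fin nt,
      Integrable (fun w => Real.log (1 + zfSINR δ (channel (P w) S) k)) μ) ∧
    (∀ r : ℝ, Separates r [1, 1] [1] →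
      IntegrableOn (fun x : ℝ => (ω x : ℂ) *
        ∑ k : Fin nt, meijerG r [1, 1] [] [1] [0] (δ * x / invDiag S k)) (Ioi 0) ∧
      (zfSumRate μ δ (fun w => channel (P w) S) : ℂ) =
        1 / (mellinAt ω 1 : ℂ) * ∫ x in Ioi (0 : ℝ), (ω x : ℂ) *
          ∑ k : Fin nt, meijerG r [1, 1] [] [1] [0] (δ * x / invDiag S k)) ∧
    -- linearity in `n_t` without transmit correlation: the factor of `n_t` involves `ω, δ` only
    (S = 1 → ∀ r : ℝ, Separates r [1, 1] [1] →
      (zfSumRate μ δ (fun w => channel (P w) S) : ℂ) =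
        (nt : ℂ) * (1 / (mellinAt ω 1 : ℂ) * ∫ x in Ioi (0 : ℝ),
          (ω x : ℂ) * meijerG r [1, 1] [] [1] [0] (δ * x))) := by
  have hn : 0 < nt := by omega
  refine ⟨hP.weight.isBiorthonormal, hP.weight.ae_differentiableAt,
    fun y hy hd => hP.weight.polyaKernel_zero_eq hn hy hd,
    fun k => hP.sinr_law hn hS hδ k,
    fun k => hP.integrable_log_one_add_zfSINR hnt hS hδ k,
    fun r hr => ⟨hP.weight.integrableOn_mul_sum_meijerG hnt hS hδ hr,
      hP.zfSumRate_eq hnt hS hδ hr⟩, ?_⟩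
  rintro rfl r hr
  exact hP.zfSumRate_one_eq hnt hδ hr
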